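/- **Proposition 3.2.** Let $r,s$ be integers of the same parity. Let $\mathcal M^!_{r,s}$ be the space of real-analytic $f:\mathfrak H\to\mathbb C$ on the upper half-plane ($z=x+iy$, $q=e^{2\pi i z}$) such that $f(\gamma z)=(cz+d)^r(c\bar z+d)^s f(z)$ for all $\gamma=\left(\begin{smallmatrix}*&*\\c&d\end{smallmatrix}\right)\in\mathrm{SL}_2(\mathbb Z)$, $f(z)=O(e^{Cy})$ as $y\to\infty$ uniformly in $x$ for some $C>0$, and $$f(z)=\sum_{|j|\le M}y^j\sum_{m,n\ge -N}A^{(j)}_{m,n}q^m\bar q^n\qquad (1)$$ for some $M,N\in\mathbb N$, $A_{m,n}^{(j)}\in\mathbb C$, with absolutely convergent inner series. Put $\partial_r=2iy\frac{\partial}{\partial z}+r$, $\bar\partial_s=-2iy\frac{\partial}{\partial\bar z}+s$ and $\Delta_{r,s}=-\bar\partial_{s-1}\partial_r+r(s-1)$. Let $\lambda\in\mathbb R$ and let $f\in\mathcal M^!_{r,s}$ satisfy $\Delta_{r,s}f=\lambda f$. If $f\neq0$, there is $k_0\in\mathbb Z$ with $k_0<1-r-s-k_0$ and $\lambda=k_0(1-r-s-k_0)$.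 For each such $k_0$ (also if $f=0$), there are unique $\alpha,\beta,a_m^{(j)},b_m^{(j)}\in\mathbb C$ such that, for some $N,N'\in\mathbb N$, $$f(z)=\alpha y^{k_0}+\beta y^{1-r-s-k_0}+\sum_{j=k_0}^{-s}y^j\sum_{m\ge -N,\,m\ne0}a_m^{(j)}q^m+\sum_{j=k_0}^{-r}y^j\sum_{m\ge -N',\,m\neq0}b_m^{(j)}\bar q^m,$$ with absolutely convergent inner series (coefficients outside the ranges of summation being $0$). Moreover: 1. For each $j\in\{k_0,\dots,-s\}$ (resp. $j\in\{k_0,\dots,-r\}$) there is $C>0$ such that $a_n^{(j)}=O(e^{C\sqrt n})$ (resp. $b_n^{(j)}=O(e^{C\sqrt n})$) as $n\to\infty$. 2. Let $\Gamma(w,z)=\int_z^\infty e^{-t}t^{w-1}\,dt$ ($z\neq0$) be the incomplete Gamma function, continued to all $w\in\mathbb C$; for $z<0$ logarithms are principal ($\arg z=\pi$) and the path runs through the upper half-plane. With $c_m^{(j)}=a_m^{(j)}+b_m^{(j)}$, both series $$S(w)=\sum_{j\in\mathbb Z}\sum_{m\ne0}\frac{c_m^{(j)}\,\Gamma(w+j,2\pi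 m)}{(2\pi m)^{w+j}}\quad\text{and}\quad S(r+s-w)$$ converge absolutely for every $w\in\mathbb C$. 3. For every expansion (1) of $f$, define $L_f^*(w)=\Lambda(w)+i^{r-s}\Lambda(r+s-w)$, where $$\Lambda(w)=\int_1^\infty\tilde f(it)t^{w-1}dt+\sum_{|j|\le M}\sum_{\substack{m,n\ge -N\\m+n<0}}\frac{A_{m,n}^{(j)}\,\Gamma(j+w,2\pi(m+n))}{(2\pi(m+n))^{j+w}}-\sum_{|j|\le M}\sum_{\substack{m,n\ge -N\\m+n=0}}\frac{A^{(j)}_{m,n}}{w+j}$$ (terms with $A_{m,n}^{(j)}=0$ being omitted) and $\tilde f$ is the sum of the terms of (1) with $m+n>0$. Then for $w\neq -k_0,\,-k_0+1,\,k_0+r+s-1,\,k_0+r+s$, $$L_f^*(w)=S(w)+i^{r-s}S(r+s-w)+\frac{i^{r-s}\alpha}{w-k_0-r-s}+\frac{i^{r-s}\beta}{w+k_0-1}-\frac{\alpha}{w+k_0}-\frac{\beta}{w-k_0-r-s+1}.$$ -/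

import Mathlib

open UpperHalfPlane hiding I
open Complex Filter Asymptotics MeasureTheory
open scoped ComplexConjugate

noncomputable section

namespace RealAnalyticModular

/-! ### Real-analytic modular forms of weights `(r, s)` for `SL(2, ℤ)` -/

/-- The automorphy factor `j(γ, z) = c z + d`, for any complex number `z`. -/
def autFactor (γ : Matrix.SpecialLinearGroup (Fin 2) ℤ) (z : ℂ) : ℂ :=
  ((γ 1 0 : ℤ) : ℂ) * z + ((γ 1 1 : ℤ) : ℂ)

/-- `q = exp(2 π i z)`. -/
def nome (z : ℂ) : ℂ := cexp (2 * Real.pi * I * z)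

/-- The monomial `q ^ m * (conj q) ^ n`. -/
def nomeMonomial (m n : ℤ) (z : ℂ) : ℂ := nome z ^ m * conj (nome z) ^ n

/-- `f(z) = ∑_{|j| ≤ M} y ^ j (∑_{m, n ≥ -N} A j m n * q ^ m * (conj q) ^ n)` on the upper
half-plane, each inner double series being absolutely convergent at every point.
Coefficients outside of the range of summation are zero by convention. -/
structure IsFourierExpansion (f : ℍ → ℂ) (M N : ℕ) (A : ℤ → ℤ → ℤ → ℂ) : Prop where
  support : ∀ j m n : ℤ, ((M : ℤ) < |j| ∨ m < -(N : ℤ) ∨ n < -(N : ℤ)) → A j m n = 0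
  summable : ∀ (j : ℤ) (z : ℍ),
    Summable fun p : ℤ × ℤ => A j p.1 p.2 * nomeMonomial p.1 p.2 (z : ℂ)
  eq : ∀ z : ℍ, f z = ∑ j ∈ Finset.Icc (-(M : ℤ)) (M : ℤ),
    (z.im : ℂ) ^ j * ∑' p : ℤ × ℤ, A j p.1 p.2 * nomeMonomial p.1 p.2 (z : ℂ)

/-- The space of real-analytic modular forms of weights `(r, s)`, with (possibly) exponential
growth at infinity. -/
structure IsModularForm (r s : ℤ) (f : ℍ → ℂ) : Prop where
  analytic : AnalyticOnNhd ℝ (f ∘ ofComplex) {z : ℂ | 0 < z.im}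
  modular : ∀ (γ : Matrix.SpecialLinearGroup (Fin 2) ℤ) (z : ℍ),
    f (γ • z) = autFactor γ (z : ℂ) ^ r * autFactor γ (conj (z : ℂ)) ^ s * f z
  growth : ∃ C : ℝ, 0 < C ∧ f =O[atImInfty] fun z : ℍ => Real.exp (C * z.im)
  expansion : ∃ (M N : ℕ) (A : ℤ → ℤ → ℤ → ℂ), IsFourierExpansion f M N A

/-! ### The Laplacian -/

/-- The Wirtinger derivative `∂f/∂z = (∂f/∂x - i ∂f/∂y) / 2`. -/
def dz (f : ℍ → ℂ) (z : ℍ) : ℂ :=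
  (fderiv ℝ (f ∘ ofComplex) (z : ℂ) 1 - I * fderiv ℝ (f ∘ ofComplex) (z : ℂ) I) / 2

/-- The Wirtinger derivative `∂f/∂(conj z) = (∂f/∂x + i ∂f/∂y) / 2`. -/
def dzbar (f : ℍ → ℂ) (z : ℍ) : ℂ :=
  (fderiv ℝ (f ∘ ofComplex) (z : ℂ) 1 + I * fderiv ℝ (f ∘ ofComplex) (z : ℂ) I) / 2

/-- The operator `2 i y ∂/∂z + r`. -/
def maassRaise (r : ℤ) (f : ℍ → ℂ) (z : ℍ) : ℂ := 2 * I * z.im * dz f z + r * f z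

/-- The operator `- 2 i y ∂/∂(conj z) + s`. -/
def maassLower (s : ℤ) (f : ℍ → ℂ) (z : ℍ) : ℂ := -2 * I * z.im * dzbar f z + s * f z

/-- The Laplacian `Δ_{r, s} = - maassLower (s - 1) ∘ maassRaise r + r (s - 1)`. -/
def laplacian (r s : ℤ) (f : ℍ → ℂ) (z : ℍ) : ℂ :=
  -maassLower (s - 1) (maassRaise r f) z + r * (s - 1) * f z

/-- The forms of weights `(r, s)` in the kernel of `Δ - lam`. -/
structure IsEigenform (r s : ℤ) (lam : ℝ) (f : ℍ → ℂ) : Prop where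
  isModularForm : IsModularForm r s f
  laplacian_eq : ∀ z : ℍ, laplacian r s f z = (lam : ℂ) * f z

/-! ### The Fourier expansion of an eigenform -/

/-- The coefficients `α, β` of the constant term and the coefficients `a j m`, `b j m` of
`y ^ j * q ^ m` and of `y ^ j * (conj q) ^ m`. -/
structure EigenCoeffs where
  α : ℂ
  β : ℂ
  a : ℤ → ℤ → ℂ
  b : ℤ → ℤ → ℂ

/-- The expansion `f(z) = α y ^ k₀ + β y ^ (1 - r - s - k₀)
  + ∑_{j = k₀}^{-s} y ^ j ∑_{m ≥ -N, m ≠ 0} a j m * q ^ m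
  + ∑_{j = k₀}^{-r} y ^ j ∑_{m ≥ -N', m ≠ 0} b j m * (conj q) ^ m` for some `N, N'`.
Coefficients outside of the range of summation are zero by convention. -/
structure IsEigenExpansion (r s k₀ : ℤ) (f : ℍ → ℂ) (E : EigenCoeffs) : Prop where
  support_a : ∃ N : ℕ, ∀ j m : ℤ, (j < k₀ ∨ -s < j ∨ m < -(N : ℤ) ∨ m = 0) → E.a j m = 0
  support_b : ∃ N' : ℕ, ∀ j m : ℤ, (j < k₀ ∨ -r < j ∨ m < -(N' : ℤ) ∨ m = 0) → E.b j m = 0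
  summable_a : ∀ (j : ℤ) (z : ℍ), Summable fun m : ℤ => E.a j m * nome (z : ℂ) ^ m
  summable_b : ∀ (j : ℤ) (z : ℍ), Summable fun m : ℤ => E.b j m * conj (nome (z : ℂ)) ^ m
  eq : ∀ z : ℍ, f z =
    (E.α * (z.im : ℂ) ^ k₀ + E.β * (z.im : ℂ) ^ (1 - r - s - k₀))
    + ∑ j ∈ Finset.Icc k₀ (-s), (z.im : ℂ) ^ j * ∑' m : ℤ, E.a j m * nome (z : ℂ) ^ m
    + ∑ j ∈ Finset.Icc k₀ (-r), (z.im : ℂ) ^ j * ∑' m : ℤ, E.b j m * conj (nome (z : ℂ)) ^ m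

/-! ### The L-function -/

/-- The incomplete Gamma function `Γ(w, z) = ∫_z^∞ e^{-t} t^{w-1} dt` for `z ≠ 0`, with the
principal branch of the logarithm (on the negative axis, `arg z = π`). The path of integration
is the arc of the circle about `0` from `z = |z| e^{i arg z}` to `|z|`, followed by the real
half-line from `|z|` to `∞`; it avoids `0`, so this is an entire function of `w`, and it is the
usual real integral when `z > 0`. -/
def incGamma (w z : ℂ) : ℂ :=
  (∫ t in Set.Ioi ‖z‖, cexp (-(t : ℂ)) * (t : ℂ) ^ (w - 1))
    - I * ∫ θ in (0 : ℝ)..(arg z),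
        cexp (-((‖z‖ : ℂ) * cexp (θ * I))) * ((‖z‖ : ℂ) ^ w * cexp (θ * I * w))

/-- The exponentially decaying part of an expansion: its terms with `m + n > 0`. -/
def decayingPart (M : ℕ) (A : ℤ → ℤ → ℤ → ℂ) (z : ℂ) : ℂ :=
  ∑ j ∈ Finset.Icc (-(M : ℤ)) (M : ℤ), (z.im : ℂ) ^ j *
    ∑' p : ℤ × ℤ, if 0 < p.1 + p.2 then A j p.1 p.2 * nomeMonomial p.1 p.2 z else 0

/-- The Mellin transform `∫_1^∞` of the decaying part at `i t`, plus the regularized one of the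
exponentially growing part (the finitely many terms with `m + n < 0`), minus the contribution
of the constant term (the finitely many terms with `m + n = 0`). -/
def halfL (M N : ℕ) (A : ℤ → ℤ → ℤ → ℂ) (w : ℂ) : ℂ :=
  (∫ t in Set.Ioi (1 : ℝ), decayingPart M A (I * t) * (t : ℂ) ^ (w - 1))
  + (∑ j ∈ Finset.Icc (-(M : ℤ)) (M : ℤ),
      ∑ m ∈ Finset.Icc (-(N : ℤ)) (N : ℤ), ∑ n ∈ Finset.Icc (-(N : ℤ)) (N : ℤ),
        if m + n < 0 then
          A j m n / (2 * Real.pi * ((m : ℂ) + n)) ^ ((j : ℂ) + w)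
            * incGamma ((j : ℂ) + w) (2 * Real.pi * ((m : ℂ) + n))
        else 0)
  - ∑ j ∈ Finset.Icc (-(M : ℤ)) (M : ℤ),
      ∑ m ∈ Finset.Icc (-(N : ℤ)) (N : ℤ), ∑ n ∈ Finset.Icc (-(N : ℤ)) (N : ℤ),
        if m + n = 0 then A j m n / (w + j) else 0

/-- The completed L-function `L*(w)` of a form of weights `(r, s)` with Fourier expansion given
by `M`, `N`, `A` (the coefficients `A` are determined by the form). -/
def completedL (r s : ℤ) (M N : ℕ) (A : ℤ → ℤ → ℤ → ℂ) (w : ℂ) : ℂ :=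
  halfL M N A w + I ^ (r - s) * halfL M N A ((r : ℂ) + s - w)

/-- The term `c_m^{(j)} Γ(w + j, 2 π m) / (2 π m) ^ (w + j)`, where
`c_m^{(j)} = a_m^{(j)} + b_m^{(j)}` and `m ≠ 0`, of the series expression; `p = (j, m)`. -/
def seriesTerm (E : EigenCoeffs) (w : ℂ) (p : ℤ × ℤ) : ℂ :=
  if p.2 = 0 then 0 else
    (E.a p.1 p.2 + E.b p.1 p.2) * incGamma (w + p.1) (2 * Real.pi * (p.2 : ℂ))
      / (2 * Real.pi * (p.2 : ℂ)) ^ (w + p.1)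

/-- The rational function `P(w)` coming from the constant term `α y ^ k₀ + β y ^ (1-r-s-k₀)`. -/
def polarPart (r s k₀ : ℤ) (E : EigenCoeffs) (w : ℂ) : ℂ :=
  I ^ (r - s) * E.α / (w - k₀ - r - s) + I ^ (r - s) * E.β / (w + k₀ - 1)
    - E.α / (w + k₀) - E.β / (w - k₀ - r - s + 1)

end RealAnalyticModular

end

/-!
In terms of the coefficients `A j m n` the equation `Δ f = lam f` is a recursion in `j`. As only
finitely many `j` occur, it forces `A j m n = 0` unless `m n = 0`, it bounds the `j` that occur
with `m = 0` or `n = 0`, and it leaves two powers of `y`, the roots of `k (1 - r - s - k) = lam`,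
in the constant term.

Modularity turns the exponential growth at `∞` into the bound `e ^ (C / y)` as `y → 0`. The
coefficients of the individual powers of `y` are isolated by Lagrange interpolation at several
heights proportional to `1 / √n`, and there the bound becomes `e ^ (C √n)`.

A Fourier expansion at `z = i t` can be integrated term by term against `t ^ (w - 1)` over
`(1, ∞)`, where it decays; this gives the incomplete Gamma functions, first as a sum over
`(j, m, n)` and then, for an eigenform, as a sum over `(j, m + n)`.
-/

namespace RealAnalyticModular

noncomputable section

/-! ### The monomials `q ^ m * conj q ^ n` -/

lemma nomeMonomial_eq_exp (m n : ℤ) (z : ℂ) :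
    nomeMonomial m n z = cexp (2 * Real.pi * I * (m * z - n * conj z)) := by
  rw [nomeMonomial, nome, ← Complex.exp_conj, ← Complex.exp_int_mul, ← Complex.exp_int_mul,
    ← Complex.exp_add]
  congr 1
  simp only [map_mul, conj_ofReal, conj_I, map_ofNat]
  ring

lemma norm_nomeMonomial (m n : ℤ) (z : ℂ) :
    ‖nomeMonomial m n z‖ = Real.exp (-(2 * Real.pi * (m + n) * z.im)) := by
  rw [nomeMonomial_eq_exp, Complex.norm_exp]
  congr 1
  simp only [mul_re, mul_im, sub_re, sub_im, re_ofNat, im_ofNat, ofReal_re, ofReal_im, Complex.I_re,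
    Complex.I_im, intCast_re, intCast_im, conj_re, conj_im]
  ring

lemma nomeMonomial_zero_right (m : ℤ) (z : ℂ) : nomeMonomial m 0 z = nome z ^ m := by
  rw [nomeMonomial, zpow_zero, mul_one]

lemma nomeMonomial_zero_left (n : ℤ) (z : ℂ) : nomeMonomial 0 n z = conj (nome z) ^ n := by
  rw [nomeMonomial, zpow_zero, one_mul]

lemma nomeMonomial_I_mul (m n : ℤ) (t : ℝ) :
    nomeMonomial m n (I * t) = Real.exp (-(2 * Real.pi * (m + n) * t)) := by
  rw [nomeMonomial_eq_exp, Complex.ofReal_exp]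
  congr 1
  simp only [map_mul, conj_I, conj_ofReal]
  push_cast
  linear_combination (2 * Real.pi * (m + n) * t) * I_sq

/-- The coefficient of `dz` in a real-linear map `ℂ → ℂ`, written as a combination of `dz` and
`d(conj z)`. -/
def holPart : (ℂ →L[ℝ] ℂ) →L[ℝ] ℂ :=
  (2⁻¹ : ℂ) • (ContinuousLinearMap.apply ℝ ℂ (1 : ℂ) - I • ContinuousLinearMap.apply ℝ ℂ I)

/-- The coefficient of `d(conj z)` in a real-linear map `ℂ → ℂ`, written as a combination of `dz`
and `d(conj z)`. -/
def antiholPart : (ℂ →L[ℝ] ℂ) →L[ℝ] ℂ :=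
  (2⁻¹ : ℂ) • (ContinuousLinearMap.apply ℝ ℂ (1 : ℂ) + I • ContinuousLinearMap.apply ℝ ℂ I)

lemma holPart_apply (L : ℂ →L[ℝ] ℂ) : holPart L = (L 1 - I * L I) / 2 := by
  simp only [holPart, smul_apply, sub_apply, ContinuousLinearMap.apply_apply, smul_eq_mul]
  ring

lemma antiholPart_apply (L : ℂ →L[ℝ] ℂ) : antiholPart L = (L 1 + I * L I) / 2 := by
  simp only [antiholPart, smul_apply, add_apply, ContinuousLinearMap.apply_apply, smul_eq_mul]
  ring

lemma holPart_smul (c : ℂ) (L : ℂ →L[ℝ] ℂ) : holPart (c • L) = c * holPart L := by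
  simp only [holPart_apply, smul_apply, smul_eq_mul]
  ring

lemma antiholPart_smul (c : ℂ) (L : ℂ →L[ℝ] ℂ) : antiholPart (c • L) = c * antiholPart L := by
  simp only [antiholPart_apply, smul_apply, smul_eq_mul]
  ring

/-- The real derivative of `q ^ m * (conj q) ^ n`. -/
def monomialDeriv (m n : ℤ) (z : ℂ) : ℂ →L[ℝ] ℂ :=
  (2 * Real.pi * I * nomeMonomial m n z) •
    ((m : ℂ) • ContinuousLinearMap.id ℝ ℂ - (n : ℂ) • (conjCLE : ℂ →L[ℝ] ℂ))

lemma hasFDerivAt_nomeMonomial (m n : ℤ) (z : ℂ) :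
    HasFDerivAt (𝕜 := ℝ) (nomeMonomial m n) (monomialDeriv m n z) z := by
  have hconj : HasFDerivAt (𝕜 := ℝ) (fun z : ℂ => conj z) (conjCLE : ℂ →L[ℝ] ℂ) z :=
    conjCLE.hasFDerivAt
  have hexponent : HasFDerivAt (𝕜 := ℝ) (fun z : ℂ => 2 * Real.pi * I * (m * z - n * conj z))
      ((2 * Real.pi * I : ℂ) •
        ((m : ℂ) • ContinuousLinearMap.id ℝ ℂ - (n : ℂ) • (conjCLE : ℂ →L[ℝ] ℂ))) z :=
    (((hasFDerivAt_id z).const_mul (m : ℂ)).sub (hconj.const_mul (n : ℂ))).const_mul _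
  have hexp := hexponent.cexp
  rw [← nomeMonomial_eq_exp, smul_smul, mul_comm (nomeMonomial m n z)] at hexp
  exact hexp.congr_of_eventuallyEq (Eventually.of_forall (nomeMonomial_eq_exp m n))

lemma norm_monomialDeriv_le (m n : ℤ) (z : ℂ) :
    ‖monomialDeriv m n z‖ ≤ 2 * Real.pi * ((|(m : ℝ)| + |(n : ℝ)|) *
      Real.exp (-(2 * Real.pi * (m + n) * z.im))) := by
  have hlin : ‖(m : ℂ) • ContinuousLinearMap.id ℝ ℂ - (n : ℂ) • (conjCLE : ℂ →L[ℝ] ℂ)‖ ≤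
      |(m : ℝ)| + |(n : ℝ)| := by
    refine (norm_sub_le _ _).trans_eq ?_
    rw [norm_smul, norm_smul, Complex.norm_intCast, Complex.norm_intCast, conjCLE_norm,
      ContinuousLinearMap.norm_id, mul_one, mul_one]
  have hconst : ‖(2 * Real.pi * I : ℂ)‖ = 2 * Real.pi := by simp [abs_of_pos Real.pi_pos]
  rw [monomialDeriv, norm_smul, norm_mul, norm_nomeMonomial, hconst, mul_assoc,
    mul_comm (Real.exp _)]
  gcongr

lemma holPart_monomialDeriv (m n : ℤ) (z : ℂ) :
    holPart (monomialDeriv m n z) = 2 * Real.pi * I * (m * nomeMonomial m n z) := by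
  rw [monomialDeriv, holPart_smul, holPart_apply]
  simp only [sub_apply, smul_apply, ContinuousLinearMap.id_apply, ContinuousLinearEquiv.coe_coe,
    conjCLE_apply, map_one, conj_I, smul_eq_mul]
  linear_combination (-(Real.pi * I * nomeMonomial m n z * (m + n))) * I_sq

lemma antiholPart_monomialDeriv (m n : ℤ) (z : ℂ) :
    antiholPart (monomialDeriv m n z) = -(2 * Real.pi * I) * (n * nomeMonomial m n z) := by
  rw [monomialDeriv, antiholPart_smul, antiholPart_apply]
  simp only [sub_apply, smul_apply, ContinuousLinearMap.id_apply, ContinuousLinearEquiv.coe_coe,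
    conjCLE_apply, map_one, conj_I, smul_eq_mul]
  linear_combination (Real.pi * I * nomeMonomial m n z * (m + n)) * I_sq

/-! ### Double series in `q` and `conj q` -/

/-- The sum of the double series `∑ a (m, n) * q ^ m * (conj q) ^ n`. -/
def doubleSeries (a : ℤ × ℤ → ℂ) (z : ℂ) : ℂ := ∑' p : ℤ × ℤ, a p * nomeMonomial p.1 p.2 z

lemma doubleSeries_const_mul (a : ℤ × ℤ → ℂ) (c z : ℂ) :
    doubleSeries (fun p => c * a p) z = c * doubleSeries a z := by
  simp only [doubleSeries, mul_assoc, tsum_mul_left]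

/-- The double series with coefficients `a` has exponents at least `-N` and converges absolutely
on the upper half-plane. -/
structure IsConvergent (N : ℕ) (a : ℤ × ℤ → ℂ) : Prop where
  support : ∀ p : ℤ × ℤ, (p.1 < -(N : ℤ) ∨ p.2 < -(N : ℤ)) → a p = 0
  summable : ∀ z : ℍ, Summable fun p : ℤ × ℤ => a p * nomeMonomial p.1 p.2 (z : ℂ)

lemma abs_add_abs_mul_exp_le {N m n y : ℝ} (hm : -N ≤ m) (hn : -N ≤ n) (hN : 0 ≤ N)
    (hy : 0 < y) :
    (|m| + |n|) * Real.exp (-(2 * Real.pi * (m + n) * y)) ≤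
      Real.exp (4 * Real.pi * N * y) / (Real.pi * y) *
        Real.exp (-(2 * Real.pi * (m + n) * (y / 2))) := by
  have hπy : 0 < Real.pi * y := by positivity
  have habs : |m| + |n| ≤ m + n + 4 * N := by
    linarith [abs_le.2 ⟨by linarith, (by linarith : m ≤ m + 2 * N)⟩,
      abs_le.2 ⟨by linarith, (by linarith : n ≤ n + 2 * N)⟩]
  have hlin : m + n + 4 * N ≤ Real.exp (Real.pi * y * (m + n + 4 * N)) / (Real.pi * y) := by
    rw [le_div_iff₀ hπy]
    linarith [Real.add_one_le_exp (Real.pi * y * (m + n + 4 * N))]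
  calc (|m| + |n|) * Real.exp (-(2 * Real.pi * (m + n) * y))
      ≤ Real.exp (Real.pi * y * (m + n + 4 * N)) / (Real.pi * y) *
        Real.exp (-(2 * Real.pi * (m + n) * y)) := by gcongr; exact habs.trans hlin
    _ = _ := by
      rw [div_mul_eq_mul_div, div_mul_eq_mul_div, ← Real.exp_add, ← Real.exp_add]
      ring_nf

lemma exp_mul_le_add_exp_mul (c : ℝ) {x y₁ y₂ : ℝ} (h₁ : y₁ ≤ x) (h₂ : x ≤ y₂) :
    Real.exp (c * x) ≤ Real.exp (c * y₁) + Real.exp (c * y₂) := by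
  rcases le_total 0 c with hc | hc
  · exact (Real.exp_le_exp.2 (mul_le_mul_of_nonneg_left h₂ hc)).trans
      (le_add_of_nonneg_left (Real.exp_pos _).le)
  · exact (Real.exp_le_exp.2 (mul_le_mul_of_nonpos_left h₁ hc)).trans
      (le_add_of_nonneg_right (Real.exp_pos _).le)

lemma norm_smul_monomialDeriv_le (a : ℤ × ℤ → ℂ) (p : ℤ × ℤ) {w : ℂ} {y₁ y₂ : ℝ}
    (h₁ : y₁ ≤ w.im) (h₂ : w.im ≤ y₂) :
    ‖a p • monomialDeriv p.1 p.2 w‖ ≤ 2 * Real.pi *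
      ((|(p.1 : ℝ)| + |(p.2 : ℝ)|) * (‖a p‖ * Real.exp (-(2 * Real.pi * (p.1 + p.2) * y₁))) +
      (|(p.1 : ℝ)| + |(p.2 : ℝ)|) * (‖a p‖ * Real.exp (-(2 * Real.pi * (p.1 + p.2) * y₂)))) := by
  have hexp := exp_mul_le_add_exp_mul (-(2 * Real.pi * (p.1 + p.2))) h₁ h₂
  simp only [neg_mul] at hexp
  rw [norm_smul]
  calc ‖a p‖ * ‖monomialDeriv p.1 p.2 w‖
      ≤ ‖a p‖ * (2 * Real.pi * ((|(p.1 : ℝ)| + |(p.2 : ℝ)|) *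
          (Real.exp (-(2 * Real.pi * (p.1 + p.2) * y₁)) +
            Real.exp (-(2 * Real.pi * (p.1 + p.2) * y₂))))) := by
        refine mul_le_mul_of_nonneg_left ((norm_monomialDeriv_le _ _ _).trans ?_) (norm_nonneg _)
        gcongr
    _ = _ := by ring

namespace IsConvergent

variable {N : ℕ} {a b : ℤ × ℤ → ℂ}

lemma summable_norm_mul_exp (h : IsConvergent N a) {y : ℝ} (hy : 0 < y) :
    Summable fun p : ℤ × ℤ => ‖a p‖ * Real.exp (-(2 * Real.pi * (p.1 + p.2) * y)) := by
  simpa only [norm_mul, norm_nomeMonomial] using (h.summable ⟨⟨0, y⟩, hy⟩).norm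

lemma summable_abs_add_abs_mul (h : IsConvergent N a) {y : ℝ} (hy : 0 < y) :
    Summable fun p : ℤ × ℤ => (|(p.1 : ℝ)| + |(p.2 : ℝ)|) *
      (‖a p‖ * Real.exp (-(2 * Real.pi * (p.1 + p.2) * y))) := by
  refine ((h.summable_norm_mul_exp (half_pos hy)).mul_left
    (Real.exp (4 * Real.pi * N * y) / (Real.pi * y))).of_nonneg_of_le
    (fun p => by positivity) fun p => ?_
  by_cases hp : p.1 < -(N : ℤ) ∨ p.2 < -(N : ℤ)
  · simp [h.support p hp]
  push Not at hp
  rw [mul_left_comm, mul_left_comm _ ‖a p‖]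
  exact mul_le_mul_of_nonneg_left (abs_add_abs_mul_exp_le (by exact_mod_cast hp.1)
    (by exact_mod_cast hp.2) N.cast_nonneg hy) (norm_nonneg _)

lemma of_norm_le (h : IsConvergent N a)
    (hb : ∀ p : ℤ × ℤ, ‖b p‖ ≤ (|(p.1 : ℝ)| + |(p.2 : ℝ)|) * ‖a p‖) : IsConvergent N b where
  support p hp := by
    have := hb p
    rwa [h.support p hp, norm_zero, mul_zero, norm_le_zero_iff] at this
  summable z := by
    refine Summable.of_norm_bounded (h.summable_abs_add_abs_mul z.im_pos) fun p => ?_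
    rw [norm_mul, norm_nomeMonomial, ← mul_assoc]
    exact mul_le_mul_of_nonneg_right (hb p) (Real.exp_pos _).le

lemma fst_mul (h : IsConvergent N a) : IsConvergent N fun p => (p.1 : ℂ) * a p := by
  refine h.of_norm_le fun p => ?_
  rw [norm_mul, Complex.norm_intCast]
  exact mul_le_mul_of_nonneg_right (le_add_of_nonneg_right (abs_nonneg _)) (norm_nonneg _)

lemma snd_mul (h : IsConvergent N a) : IsConvergent N fun p => (p.2 : ℂ) * a p := by
  refine h.of_norm_le fun p => ?_
  rw [norm_mul, Complex.norm_intCast]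
  exact mul_le_mul_of_nonneg_right (le_add_of_nonneg_left (abs_nonneg _)) (norm_nonneg _)

lemma const_mul (h : IsConvergent N a) (c : ℂ) : IsConvergent N fun p => c * a p where
  support p hp := by rw [h.support p hp, mul_zero]
  summable z := by simpa only [mul_assoc] using (h.summable z).mul_left c

lemma add (h : IsConvergent N a) (h' : IsConvergent N b) : IsConvergent N fun p => a p + b p where
  support p hp := by rw [h.support p hp, h'.support p hp, add_zero]
  summable z := by simpa only [add_mul] using (h.summable z).add (h'.summable z)

lemma doubleSeries_add (h : IsConvergent N a) (h' : IsConvergent N b) (z : ℍ) :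
    doubleSeries (fun p => a p + b p) z = doubleSeries a z + doubleSeries b z := by
  simp only [doubleSeries, add_mul]
  exact (h.summable z).tsum_add (h'.summable z)

lemma summable_smul_monomialDeriv (h : IsConvergent N a) (z : ℍ) :
    Summable fun p : ℤ × ℤ => a p • monomialDeriv p.1 p.2 z :=
  Summable.of_norm_bounded
    (((h.summable_abs_add_abs_mul z.im_pos).add (h.summable_abs_add_abs_mul z.im_pos)).mul_left
      (2 * Real.pi))
    fun p => norm_smul_monomialDeriv_le a p le_rfl le_rfl

lemma hasFDerivAt (h : IsConvergent N a) (z : ℍ) :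
    HasFDerivAt (𝕜 := ℝ) (doubleSeries a)
      (∑' p : ℤ × ℤ, a p • monomialDeriv p.1 p.2 z) (z : ℂ) := by
  let S : Set ℂ := Complex.im ⁻¹' Set.Ioo (z.im / 2) (2 * z.im)
  have hzS : (z : ℂ) ∈ S := by
    have : 0 < (z : ℂ).im := z.im_pos
    exact ⟨half_lt_self this, lt_two_mul_self this⟩
  have hS : IsOpen S := isOpen_Ioo.preimage Complex.continuous_im
  have hS' : IsPreconnected S :=
    ((convex_Ioo _ _).is_linear_preimage Complex.imLm.isLinear).isPreconnected
  refine hasFDerivAt_tsum_of_isPreconnected (((h.summable_abs_add_abs_mul (half_pos z.im_pos)).add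
      (h.summable_abs_add_abs_mul (mul_pos two_pos z.im_pos))).mul_left (2 * Real.pi)) hS hS'
    (fun p w _ => (hasFDerivAt_nomeMonomial p.1 p.2 w).const_mul (a p))
    (fun p w hw => norm_smul_monomialDeriv_le a p hw.1.le hw.2.le) hzS (h.summable z) hzS

lemma holPart_deriv (h : IsConvergent N a) (z : ℍ) :
    holPart (∑' p : ℤ × ℤ, a p • monomialDeriv p.1 p.2 z) =
      2 * Real.pi * I * doubleSeries (fun p => p.1 * a p) z := by
  rw [holPart.map_tsum (h.summable_smul_monomialDeriv z), ← doubleSeries_const_mul, doubleSeries]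
  refine tsum_congr fun p => ?_
  rw [holPart_smul, holPart_monomialDeriv]
  ring

lemma antiholPart_deriv (h : IsConvergent N a) (z : ℍ) :
    antiholPart (∑' p : ℤ × ℤ, a p • monomialDeriv p.1 p.2 z) =
      -(2 * Real.pi * I) * doubleSeries (fun p => p.2 * a p) z := by
  rw [antiholPart.map_tsum (h.summable_smul_monomialDeriv z), ← doubleSeries_const_mul,
    doubleSeries]
  refine tsum_congr fun p => ?_
  rw [antiholPart_smul, antiholPart_monomialDeriv]
  ring

end IsConvergent

/-! ### The action of the Maass operators on Fourier expansions -/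

lemma hasFDerivAt_im_zpow (j : ℤ) {z : ℂ} (hz : 0 < z.im) :
    HasFDerivAt (𝕜 := ℝ) (fun w : ℂ => (w.im : ℂ) ^ j)
      ((j * (z.im : ℂ) ^ (j - 1)) • (ofRealCLM.comp imCLM)) z :=
  HasDerivAt.comp_hasFDerivAt (f := fun w : ℂ => (w.im : ℂ)) z
    (hasDerivAt_zpow j _ (Or.inl (ofReal_ne_zero.2 hz.ne'))) (ofRealCLM.comp imCLM).hasFDerivAt

lemma dz_eq_holPart (f : ℍ → ℂ) (z : ℍ) :
    dz f z = holPart (fderiv ℝ (f ∘ ofComplex) (z : ℂ)) := by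
  rw [dz, holPart_apply]

lemma dzbar_eq_antiholPart (f : ℍ → ℂ) (z : ℍ) :
    dzbar f z = antiholPart (fderiv ℝ (f ∘ ofComplex) (z : ℂ)) := by
  rw [dzbar, antiholPart_apply]

namespace IsFourierExpansion

variable {f g : ℍ → ℂ} {M N : ℕ} {A B : ℤ → ℤ → ℤ → ℂ}

lemma isConvergent (h : IsFourierExpansion f M N A) (j : ℤ) :
    IsConvergent N fun p => A j p.1 p.2 where
  support p hp := h.support j p.1 p.2 (Or.inr hp)
  summable := h.summable j

lemma coeff_eq_zero (h : IsFourierExpansion f M N A) {j : ℤ}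
    (hj : j ∉ Finset.Icc (-(M : ℤ)) (M : ℤ)) (m n : ℤ) : A j m n = 0 := by
  rw [Finset.mem_Icc, ← abs_le] at hj
  exact h.support j m n (Or.inl (not_le.1 hj))

lemma hasSum (h : IsFourierExpansion f M N A) (z : ℍ) :
    HasSum (fun j : ℤ => (z.im : ℂ) ^ j * doubleSeries (fun p => A j p.1 p.2) z) (f z) := by
  rw [h.eq z]
  refine hasSum_sum_of_ne_finset_zero fun j hj => ?_
  simp only [doubleSeries, h.coeff_eq_zero hj, zero_mul, tsum_zero, mul_zero]

lemma of_hasSum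
    (support : ∀ j m n : ℤ, ((M : ℤ) < |j| ∨ m < -(N : ℤ) ∨ n < -(N : ℤ)) → A j m n = 0)
    (conv : ∀ j : ℤ, IsConvergent N fun p => A j p.1 p.2)
    (hsum : ∀ z : ℍ, HasSum
      (fun j : ℤ => (z.im : ℂ) ^ j * doubleSeries (fun p => A j p.1 p.2) z) (f z)) :
    IsFourierExpansion f M N A where
  support := support
  summable j := (conv j).summable
  eq z := by
    refine (hsum z).unique (hasSum_sum_of_ne_finset_zero fun j hj => ?_)
    rw [Finset.mem_Icc, ← abs_le] at hj
    have hA : ∀ m n, A j m n = 0 := fun m n => support j m n (Or.inl (not_le.1 hj))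
    simp only [doubleSeries, hA, zero_mul, tsum_zero, mul_zero]

lemma mono (h : IsFourierExpansion f M N A) {M' N' : ℕ} (hM : M ≤ M') (hN : N ≤ N') :
    IsFourierExpansion f M' N' A := by
  have hs : ∀ j m n : ℤ, ((M' : ℤ) < |j| ∨ m < -(N' : ℤ) ∨ n < -(N' : ℤ)) → A j m n = 0 :=
    fun j m n hjmn => h.support j m n (by omega)
  exact of_hasSum hs (fun j => ⟨fun p hp => hs j p.1 p.2 (Or.inr hp), h.summable j⟩) h.hasSum

lemma const_mul (h : IsFourierExpansion f M N A) (c : ℂ) :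
    IsFourierExpansion (fun z => c * f z) M N fun j m n => c * A j m n := by
  refine of_hasSum (fun j m n hjmn => by rw [h.support j m n hjmn, mul_zero])
    (fun j => (h.isConvergent j).const_mul c) fun z => ?_
  refine ((h.hasSum z).mul_left c).congr_fun fun j => ?_
  rw [doubleSeries_const_mul]
  ring

lemma add (h : IsFourierExpansion f M N A) (h' : IsFourierExpansion g M N B) :
    IsFourierExpansion (fun z => f z + g z) M N fun j m n => A j m n + B j m n := by
  refine of_hasSum (fun j m n hjmn => by rw [h.support j m n hjmn, h'.support j m n hjmn, add_zero])
    (fun j => (h.isConvergent j).add (h'.isConvergent j)) fun z => ?_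
  refine ((h.hasSum z).add (h'.hasSum z)).congr_fun fun j => ?_
  rw [(h.isConvergent j).doubleSeries_add (h'.isConvergent j)]
  ring

lemma im_mul (h : IsFourierExpansion f M N A) :
    IsFourierExpansion (fun z => z.im * f z) (M + 1) N fun j => A (j - 1) := by
  refine of_hasSum (fun j m n hjmn => h.support _ m n (hjmn.imp_left fun hj => ?_))
    (fun j => h.isConvergent (j - 1)) fun z => ?_
  · have := abs_sub_abs_le_abs_sub j 1
    rw [abs_one] at this
    push_cast at hj
    omega
  · have hy : (z.im : ℂ) ≠ 0 := ofReal_ne_zero.2 z.im_pos.ne'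
    refine ((Equiv.subRight (1 : ℤ)).hasSum_iff.2 ((h.hasSum z).mul_left (z.im : ℂ))).congr_fun
      fun j => ?_
    rw [Function.comp_apply, Equiv.subRight_apply, ← mul_assoc, ← zpow_one_add₀ hy,
      add_sub_cancel]

lemma hasFDerivAt (h : IsFourierExpansion f M N A) (z : ℍ) :
    HasFDerivAt (𝕜 := ℝ) (f ∘ ofComplex)
      (∑ j ∈ Finset.Icc (-(M : ℤ)) (M : ℤ),
        (((z : ℂ).im : ℂ) ^ j • ∑' p : ℤ × ℤ, A j p.1 p.2 • monomialDeriv p.1 p.2 z +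
          doubleSeries (fun p => A j p.1 p.2) z •
            ((j * ((z : ℂ).im : ℂ) ^ (j - 1)) • (ofRealCLM.comp imCLM)))) (z : ℂ) := by
  refine (HasFDerivAt.fun_sum fun j _ => (hasFDerivAt_im_zpow j z.im_pos).mul
    ((h.isConvergent j).hasFDerivAt z)).congr_of_eventuallyEq ?_
  filter_upwards [isOpen_upperHalfPlaneSet.mem_nhds z.im_pos] with w hw
  rw [Function.comp_apply, ofComplex_apply_of_im_pos hw, h.eq]
  rfl

lemma dz_eq (h : IsFourierExpansion f M N A) (z : ℍ) :
    dz f z = ∑ j ∈ Finset.Icc (-(M : ℤ)) (M : ℤ), ((z.im : ℂ) ^ j *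
        (2 * Real.pi * I * doubleSeries (fun p => p.1 * A j p.1 p.2) z) +
        doubleSeries (fun p => A j p.1 p.2) z * (j * (z.im : ℂ) ^ (j - 1) * (-I / 2))) := by
  have him : holPart (ofRealCLM.comp imCLM) = -I / 2 := by simp [holPart_apply]
  rw [dz_eq_holPart, (h.hasFDerivAt z).fderiv, map_sum]
  refine Finset.sum_congr rfl fun j _ => ?_
  rw [map_add, holPart_smul, holPart_smul, holPart_smul, (h.isConvergent j).holPart_deriv z, him]
  rfl

lemma dzbar_eq (h : IsFourierExpansion f M N A) (z : ℍ) :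
    dzbar f z = ∑ j ∈ Finset.Icc (-(M : ℤ)) (M : ℤ), ((z.im : ℂ) ^ j *
        (-(2 * Real.pi * I) * doubleSeries (fun p => p.2 * A j p.1 p.2) z) +
        doubleSeries (fun p => A j p.1 p.2) z * (j * (z.im : ℂ) ^ (j - 1) * (I / 2))) := by
  have him : antiholPart (ofRealCLM.comp imCLM) = I / 2 := by simp [antiholPart_apply]
  rw [dzbar_eq_antiholPart, (h.hasFDerivAt z).fderiv, map_sum]
  refine Finset.sum_congr rfl fun j _ => ?_
  rw [map_add, antiholPart_smul, antiholPart_smul, antiholPart_smul,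
    (h.isConvergent j).antiholPart_deriv z, him]
  rfl

lemma of_sum_add_im_mul {A₀ A₁ : ℤ → ℤ → ℤ → ℂ}
    (hA : ∀ j m n : ℤ, ((M : ℤ) < |j| ∨ m < -(N : ℤ) ∨ n < -(N : ℤ)) →
      A₀ j m n = 0 ∧ A₁ j m n = 0)
    (h₀ : ∀ j, IsConvergent N fun p => A₀ j p.1 p.2)
    (h₁ : ∀ j, IsConvergent N fun p => A₁ j p.1 p.2)
    (hf : ∀ z : ℍ, f z = ∑ j ∈ Finset.Icc (-(M : ℤ)) (M : ℤ),
      ((z.im : ℂ) ^ j * doubleSeries (fun p => A₀ j p.1 p.2) z +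
        z.im * ((z.im : ℂ) ^ j * doubleSeries (fun p => A₁ j p.1 p.2) z))) :
    IsFourierExpansion f (M + 1) N fun j m n => A₀ j m n + A₁ (j - 1) m n := by
  have e₀ : IsFourierExpansion (fun z => ∑ j ∈ Finset.Icc (-(M : ℤ)) (M : ℤ),
      (z.im : ℂ) ^ j * doubleSeries (fun p => A₀ j p.1 p.2) z) M N A₀ :=
    ⟨fun j m n h => (hA j m n h).1, fun j => (h₀ j).summable, fun _ => rfl⟩
  have e₁ : IsFourierExpansion (fun z => ∑ j ∈ Finset.Icc (-(M : ℤ)) (M : ℤ),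
      (z.im : ℂ) ^ j * doubleSeries (fun p => A₁ j p.1 p.2) z) M N A₁ :=
    ⟨fun j m n h => (hA j m n h).2, fun j => (h₁ j).summable, fun _ => rfl⟩
  convert (e₀.mono M.le_succ le_rfl).add e₁.im_mul using 2 with z
  rw [hf, Finset.sum_add_distrib, Finset.mul_sum]

theorem maassRaise (h : IsFourierExpansion f M N A) (r : ℤ) :
    IsFourierExpansion (maassRaise r f) (M + 1) N fun j m n =>
      ((j : ℂ) + r) * A j m n + -(4 * Real.pi) * (m * A (j - 1) m n) := by
  refine of_sum_add_im_mul (A₀ := fun j m n => ((j : ℂ) + r) * A j m n)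
    (A₁ := fun j m n => -(4 * Real.pi) * (m * A j m n))
    (fun j m n hjmn => by simp [h.support j m n hjmn])
    (fun j => (h.isConvergent j).const_mul _)
    (fun j => (h.isConvergent j).fst_mul.const_mul _) fun z => ?_
  have hy : (z.im : ℂ) ≠ 0 := ofReal_ne_zero.2 z.im_pos.ne'
  rw [RealAnalyticModular.maassRaise, h.dz_eq z, h.eq z, Finset.mul_sum, Finset.mul_sum,
    ← Finset.sum_add_distrib]
  refine Finset.sum_congr rfl fun j _ => ?_
  rw [doubleSeries_const_mul, doubleSeries_const_mul, zpow_sub_one₀ hy]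
  change _ + _ * (_ * doubleSeries (fun p => A j p.1 p.2) z) = _
  field_simp
  linear_combination (4 * Real.pi * z.im * doubleSeries (fun p => p.1 * A j p.1 p.2) z
    - j * doubleSeries (fun p => A j p.1 p.2) z) * I_sq

theorem maassLower (h : IsFourierExpansion f M N A) (s : ℤ) :
    IsFourierExpansion (maassLower s f) (M + 1) N fun j m n =>
      ((j : ℂ) + s) * A j m n + -(4 * Real.pi) * (n * A (j - 1) m n) := by
  refine of_sum_add_im_mul (A₀ := fun j m n => ((j : ℂ) + s) * A j m n)
    (A₁ := fun j m n => -(4 * Real.pi) * (n * A j m n))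
    (fun j m n hjmn => by simp [h.support j m n hjmn])
    (fun j => (h.isConvergent j).const_mul _)
    (fun j => (h.isConvergent j).snd_mul.const_mul _) fun z => ?_
  have hy : (z.im : ℂ) ≠ 0 := ofReal_ne_zero.2 z.im_pos.ne'
  rw [RealAnalyticModular.maassLower, h.dzbar_eq z, h.eq z, Finset.mul_sum, Finset.mul_sum,
    ← Finset.sum_add_distrib]
  refine Finset.sum_congr rfl fun j _ => ?_
  rw [doubleSeries_const_mul, doubleSeries_const_mul, zpow_sub_one₀ hy]
  change _ + _ * (_ * doubleSeries (fun p => A j p.1 p.2) z) = _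
  field_simp
  linear_combination (4 * Real.pi * z.im * doubleSeries (fun p => p.2 * A j p.1 p.2) z
    - j * doubleSeries (fun p => A j p.1 p.2) z) * I_sq

theorem laplacian_sub_mul (h : IsFourierExpansion f M N A) (r s : ℤ) (lam : ℂ) :
    IsFourierExpansion (fun z => laplacian r s f z - lam * f z) (M + 2) N fun j m n =>
      (-(j * (j + r + s - 1)) - lam) * A j m n
        + 4 * Real.pi * (n * (j - 1 + r) + m * (j - 1 + s)) * A (j - 1) m n
        - 16 * Real.pi ^ 2 * m * n * A (j - 2) m n := by
  convert (((h.maassRaise r).maassLower (s - 1)).const_mul (-1)).add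
    ((h.const_mul ((r : ℂ) * (s - 1) - lam)).mono (by omega) le_rfl) using 1
  · funext z
    rw [laplacian]
    ring
  · funext j m n
    rw [show j - 1 - 1 = j - 2 by ring]
    push_cast
    ring

end IsFourierExpansion

/-! ### Fourier coefficients -/

lemma norm_cexp_two_pi_I_mul (m : ℤ) (x : ℝ) : ‖cexp (2 * Real.pi * I * m * x)‖ = 1 := by
  rw [show (2 * Real.pi * I * m * x : ℂ) = (2 * Real.pi * m * x : ℝ) * I by push_cast; ring,
    Complex.norm_exp_ofReal_mul_I]

lemma integral_cexp_two_pi_I_mul (k : ℤ) :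
    ∫ x in (0 : ℝ)..1, cexp (2 * Real.pi * I * k * x) = if k = 0 then 1 else 0 := by
  split_ifs with hk
  · simp [hk]
  · have hc : (2 * Real.pi * I * k : ℂ) ≠ 0 :=
      mul_ne_zero two_pi_I_ne_zero (Int.cast_ne_zero.2 hk)
    have hperiod : cexp (2 * Real.pi * I * k) = 1 := by
      rw [mul_comm]
      exact Complex.exp_int_mul_two_pi_mul_I k
    rw [integral_exp_mul_complex hc, ofReal_one, ofReal_zero, mul_one, mul_zero, hperiod,
      Complex.exp_zero, sub_self, zero_div]

lemma hasSum_fourierCoeff {ι : Type*} [Countable ι] {c : ι → ℂ} (k : ι → ℤ)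
    (hc : Summable fun p => ‖c p‖) (l : ℤ) :
    HasSum (fun p => if k p = l then c p else 0)
      (∫ x in (0 : ℝ)..1, (∑' p, c p * cexp (2 * Real.pi * I * k p * x)) *
        cexp (2 * Real.pi * I * (-l : ℤ) * x)) := by
  have hsum : ∀ x : ℝ, Summable fun p => c p * cexp (2 * Real.pi * I * k p * x) := fun x =>
    Summable.of_norm (by simpa only [norm_mul, norm_cexp_two_pi_I_mul, mul_one] using hc)
  have h := intervalIntegral.hasSum_integral_of_dominated_convergence (a := 0) (b := 1)
    (μ := volume)
    (F := fun p (x : ℝ) => c p * cexp (2 * Real.pi * I * k p * x) *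
      cexp (2 * Real.pi * I * (-l : ℤ) * x))
    (fun p _ => ‖c p‖)
    (fun p => Continuous.aestronglyMeasurable (by fun_prop))
    (fun p => Eventually.of_forall fun x _ => by
      rw [norm_mul, norm_mul, norm_cexp_two_pi_I_mul, norm_cexp_two_pi_I_mul, mul_one, mul_one])
    (Eventually.of_forall fun x _ => hc)
    intervalIntegrable_const
    (Eventually.of_forall fun x _ => (hsum x).hasSum.mul_right _)
  refine h.congr_fun fun p => ?_
  have hshift : ∀ x : ℝ, c p * cexp (2 * Real.pi * I * k p * x) *
      cexp (2 * Real.pi * I * (-l : ℤ) * x) =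
      c p * cexp (2 * Real.pi * I * ((k p - l : ℤ) : ℂ) * x) := by
    intro x
    rw [mul_assoc, ← Complex.exp_add]
    congr 2
    push_cast
    ring
  simp only [hshift, intervalIntegral.integral_const_mul, integral_cexp_two_pi_I_mul, sub_eq_zero,
    mul_ite, mul_one, mul_zero]

lemma nomeMonomial_mk (m n : ℤ) (x : ℝ) {y : ℝ} (hy : 0 < y) :
    nomeMonomial m n (⟨⟨x, y⟩, hy⟩ : ℍ) =
      Real.exp (-(2 * Real.pi * (m + n) * y)) *
        cexp (2 * Real.pi * I * ((m - n : ℤ) : ℂ) * x) := by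
  rw [nomeMonomial_eq_exp, Complex.ofReal_exp, ← Complex.exp_add]
  congr 1
  change 2 * Real.pi * I * (m * (⟨x, y⟩ : ℂ) - n * conj (⟨x, y⟩ : ℂ)) = _
  rw [show (⟨x, y⟩ : ℂ) = x + y * I from mk_eq_add_mul_I x y]
  simp only [map_add, map_mul, conj_ofReal, conj_I]
  push_cast
  linear_combination (2 * Real.pi * (m + n) * y) * I_sq

/-- The Laurent polynomial `∑_{|j| ≤ M} c j * y ^ j`. -/
def laurentSum (M : ℕ) (c : ℤ → ℂ) (y : ℝ) : ℂ :=
  ∑ j ∈ Finset.Icc (-(M : ℤ)) (M : ℤ), (y : ℂ) ^ j * c j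

/-- The term of index `(m, n)` of a Fourier expansion on the line `im z = y`, without its phase
`exp (2 π i (m - n) x)`. -/
def lineCoeff (M : ℕ) (A : ℤ → ℤ → ℤ → ℂ) (y : ℝ) (p : ℤ × ℤ) : ℂ :=
  laurentSum M (fun j => A j p.1 p.2) y * Real.exp (-(2 * Real.pi * (p.1 + p.2) * y))

lemma norm_lineCoeff (M : ℕ) (A : ℤ → ℤ → ℤ → ℂ) (y : ℝ) (p : ℤ × ℤ) :
    ‖lineCoeff M A y p‖ = ‖laurentSum M (fun j => A j p.1 p.2) y‖ *
      Real.exp (-(2 * Real.pi * (p.1 + p.2) * y)) := by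
  rw [lineCoeff, norm_mul, Complex.norm_real, Real.norm_of_nonneg (Real.exp_pos _).le]

lemma norm_laurentSum_le (M : ℕ) (c : ℤ → ℂ) {y : ℝ} (hy : 0 < y) :
    ‖laurentSum M c y‖ ≤ ∑ j ∈ Finset.Icc (-(M : ℤ)) (M : ℤ), y ^ j * ‖c j‖ := by
  refine norm_sum_le_of_le _ fun j _ => ?_
  rw [norm_mul, norm_zpow, Complex.norm_real, Real.norm_of_nonneg hy.le]

lemma norm_lineCoeff_le_of_le_add (M : ℕ) (A : ℤ → ℤ → ℤ → ℂ) {y c : ℝ} (hy : 1 ≤ y)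
    {p : ℤ × ℤ} (hp : c ≤ p.1 + p.2) :
    ‖lineCoeff M A y p‖ ≤ Real.exp (-(2 * Real.pi * c * (y - 1))) * y ^ M *
      ∑ j ∈ Finset.Icc (-(M : ℤ)) (M : ℤ),
        ‖A j p.1 p.2‖ * Real.exp (-(2 * Real.pi * (p.1 + p.2) * 1)) := by
  have hy0 : 0 < y := one_pos.trans_le hy
  have hexp : Real.exp (-(2 * Real.pi * (p.1 + p.2) * y)) ≤
      Real.exp (-(2 * Real.pi * c * (y - 1))) *
        Real.exp (-(2 * Real.pi * (p.1 + p.2) * 1)) := by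
    rw [← Real.exp_add, Real.exp_le_exp]
    linarith [mul_nonneg (mul_nonneg Real.two_pi_pos.le (sub_nonneg.2 hp)) (sub_nonneg.2 hy)]
  have hpow : ‖laurentSum M (fun j => A j p.1 p.2) y‖ ≤
      ∑ j ∈ Finset.Icc (-(M : ℤ)) (M : ℤ), y ^ M * ‖A j p.1 p.2‖ := by
    refine (norm_laurentSum_le M _ hy0).trans (Finset.sum_le_sum fun j hj => ?_)
    rw [← zpow_natCast]
    gcongr
    exact (Finset.mem_Icc.1 hj).2
  rw [norm_lineCoeff]
  refine (mul_le_mul hpow hexp (Real.exp_pos _).le (norm_nonneg _ |>.trans hpow)).trans_eq ?_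
  rw [← Finset.mul_sum, ← Finset.sum_mul]
  ring

namespace IsFourierExpansion

variable {f : ℍ → ℂ} {M N : ℕ} {A : ℤ → ℤ → ℤ → ℂ}

lemma summable_norm_lineCoeff (h : IsFourierExpansion f M N A) {y : ℝ} (hy : 0 < y) :
    Summable fun p => ‖lineCoeff M A y p‖ := by
  have hs : Summable fun p : ℤ × ℤ => ∑ j ∈ Finset.Icc (-(M : ℤ)) (M : ℤ),
      y ^ j * (‖A j p.1 p.2‖ * Real.exp (-(2 * Real.pi * (p.1 + p.2) * y))) :=
    summable_sum fun j _ => ((h.isConvergent j).summable_norm_mul_exp hy).mul_left (y ^ j)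
  refine hs.of_nonneg_of_le (fun p => norm_nonneg _) fun p => ?_
  simp only [norm_lineCoeff, ← mul_assoc, ← Finset.sum_mul]
  exact mul_le_mul_of_nonneg_right (norm_laurentSum_le M _ hy) (Real.exp_pos _).le

lemma eq_tsum_lineCoeff (h : IsFourierExpansion f M N A) (x : ℝ) {y : ℝ} (hy : 0 < y) :
    f ⟨⟨x, y⟩, hy⟩ =
      ∑' p : ℤ × ℤ, lineCoeff M A y p * cexp (2 * Real.pi * I * ((p.1 - p.2 : ℤ) : ℂ) * x) := by
  have hswap : ∀ z : ℍ, f z = ∑' p : ℤ × ℤ, ∑ j ∈ Finset.Icc (-(M : ℤ)) (M : ℤ),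
      (z.im : ℂ) ^ j * (A j p.1 p.2 * nomeMonomial p.1 p.2 z) := by
    intro z
    simp only [h.eq, ← tsum_mul_left]
    exact (Summable.tsum_finsetSum fun j _ => (h.summable j z).mul_left _).symm
  refine (hswap _).trans (tsum_congr fun p => ?_)
  rw [lineCoeff, laurentSum, Finset.sum_mul, Finset.sum_mul]
  refine Finset.sum_congr rfl fun j _ => ?_
  rw [nomeMonomial_mk]
  change (y : ℂ) ^ j * _ = _
  ring

lemma hasSum_lineCoeff (h : IsFourierExpansion f M N A) {y : ℝ} (hy : 0 < y) (l : ℤ) :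
    HasSum (fun p : ℤ × ℤ => if p.1 - p.2 = l then lineCoeff M A y p else 0)
      (∫ x in (0 : ℝ)..1, f ⟨⟨x, y⟩, hy⟩ * cexp (2 * Real.pi * I * (-l : ℤ) * x)) := by
  simpa only [h.eq_tsum_lineCoeff _ hy] using
    hasSum_fourierCoeff (fun p : ℤ × ℤ => p.1 - p.2) (h.summable_norm_lineCoeff hy) l

end IsFourierExpansion

/-! ### Coefficients of Laurent polynomials in terms of their values -/

lemma exists_norm_le_mul_sum_norm_mulVec {n : Type*} [Fintype n] [DecidableEq n]
    {A : Matrix n n ℂ} (hA : IsUnit A.det) :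
    ∃ K : ℝ, 0 ≤ K ∧ ∀ (v : n → ℂ) (i : n), ‖v i‖ ≤ K * ∑ k, ‖A.mulVec v k‖ := by
  refine ⟨∑ i, ∑ k, ‖A⁻¹ i k‖, by positivity, fun v i => ?_⟩
  have hv : v i = ∑ k, A⁻¹ i k * A.mulVec v k := by
    conv_lhs => rw [← Matrix.one_mulVec v, ← Matrix.nonsing_inv_mul A hA, ← Matrix.mulVec_mulVec]
    rfl
  calc ‖v i‖ ≤ ∑ k, ‖A⁻¹ i k‖ * ‖A.mulVec v k‖ := by
        rw [hv]
        exact norm_sum_le_of_le _ fun k _ => norm_mul_le _ _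
    _ ≤ ∑ k, (∑ i, ∑ k, ‖A⁻¹ i k‖) * ‖A.mulVec v k‖ := by
        refine Finset.sum_le_sum fun k _ => mul_le_mul_of_nonneg_right ?_ (norm_nonneg _)
        exact (Finset.single_le_sum (f := fun k => ‖A⁻¹ i k‖) (fun _ _ => norm_nonneg _)
          (Finset.mem_univ k)).trans (Finset.single_le_sum (f := fun i => ∑ k, ‖A⁻¹ i k‖)
            (fun _ _ => Finset.sum_nonneg fun _ _ => norm_nonneg _) (Finset.mem_univ i))
    _ = _ := by rw [Finset.mul_sum]

lemma sum_pow_mul_eq_pow_mul_laurentSum (M : ℕ) (c : ℤ → ℂ) {y : ℝ} (hy : y ≠ 0) :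
    ∑ i : Fin (2 * M + 1), (y : ℂ) ^ (i : ℕ) * c (i - M) = (y : ℂ) ^ M * laurentSum M c y := by
  have hy' : (y : ℂ) ≠ 0 := ofReal_ne_zero.2 hy
  rw [Fin.sum_univ_eq_sum_range fun i => (y : ℂ) ^ i * c (i - M), laurentSum, Finset.mul_sum]
  refine Finset.sum_nbij' (fun i => (i : ℤ) - M) (fun j => (j + M).toNat)
    (fun i hi => ?_) (fun j hj => ?_) (fun i _ => ?_) (fun j hj => ?_) (fun i _ => ?_)
  · rw [Finset.mem_range] at hi
    rw [Finset.mem_Icc]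
    omega
  · rw [Finset.mem_Icc] at hj
    rw [Finset.mem_range]
    omega
  · omega
  · rw [Finset.mem_Icc] at hj
    omega
  · rw [zpow_sub₀ hy', zpow_natCast, zpow_natCast]
    field_simp

/-- Lagrange interpolation at the points `T, 2 T, …, (2 M + 1) T`. -/
theorem exists_norm_coeff_le_sum_norm_laurentSum (M : ℕ) :
    ∃ K : ℝ, 0 ≤ K ∧ ∀ (c : ℤ → ℂ) (T : ℝ), 0 < T → ∀ j ∈ Finset.Icc (-(M : ℤ)) (M : ℤ),
      T ^ j * ‖c j‖ ≤ K * ∑ k : Fin (2 * M + 1), ‖laurentSum M c (T * (k + 1))‖ := by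
  let V : Matrix (Fin (2 * M + 1)) (Fin (2 * M + 1)) ℂ :=
    Matrix.vandermonde fun k => ((k + 1 : ℝ) : ℂ)
  have hV : IsUnit V.det := by
    refine isUnit_iff_ne_zero.2 (Matrix.det_vandermonde_ne_zero_iff.2 fun k l hkl => ?_)
    exact Fin.ext (by exact_mod_cast add_right_cancel (ofReal_injective hkl))
  obtain ⟨K, hK, hbound⟩ := exists_norm_le_mul_sum_norm_mulVec hV
  refine ⟨K * (2 * M + 1) ^ M, by positivity, fun c T hT j hj => ?_⟩
  rw [Finset.mem_Icc] at hj
  have hi : (((j + M).toNat : ℕ) : ℤ) - M = j := by omega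
  have h := hbound (fun i => (T : ℂ) ^ ((i : ℤ) - M) * c (i - M)) ⟨(j + M).toNat, by omega⟩
  rw [hi, norm_mul, norm_zpow, Complex.norm_real, Real.norm_of_nonneg hT.le] at h
  refine h.trans ?_
  rw [mul_assoc, Finset.mul_sum (a := (_ : ℝ) ^ M)]
  refine mul_le_mul_of_nonneg_left (Finset.sum_le_sum fun k _ => ?_) hK
  have hvalue : V.mulVec (fun i => (T : ℂ) ^ ((i : ℤ) - M) * c (i - M)) k =
      ((k + 1 : ℝ) : ℂ) ^ M * laurentSum M c (T * (k + 1)) := by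
    have hk : (k + 1 : ℝ) ≠ 0 := by positivity
    refine (sum_pow_mul_eq_pow_mul_laurentSum M (fun j => (T : ℂ) ^ j * c j) hk).trans ?_
    simp only [laurentSum, ofReal_mul, mul_zpow, mul_assoc, mul_left_comm]
  have hle : (k + 1 : ℝ) ≤ 2 * M + 1 := by exact_mod_cast Nat.succ_le_of_lt k.is_lt
  rw [hvalue, norm_mul, norm_pow, Complex.norm_real, Real.norm_of_nonneg (by positivity)]
  gcongr

lemma coeff_eq_zero_of_tendsto_laurentSum {M : ℕ} {c : ℤ → ℂ}
    (h : Tendsto (fun y : ℝ => y ^ M * ‖laurentSum M c y‖) atTop (nhds 0)) {j : ℤ}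
    (hj : j ∈ Finset.Icc (-(M : ℤ)) (M : ℤ)) : c j = 0 := by
  obtain ⟨K, hK, hbound⟩ := exists_norm_coeff_le_sum_norm_laurentSum M
  have hlim : Tendsto (fun T : ℝ => K * ∑ k : Fin (2 * M + 1),
      (T * (k + 1)) ^ M * ‖laurentSum M c (T * (k + 1))‖) atTop (nhds 0) := by
    have hk : ∀ k : Fin (2 * M + 1), Tendsto (fun T : ℝ =>
        (T * (k + 1)) ^ M * ‖laurentSum M c (T * (k + 1))‖) atTop (nhds 0) := fun k =>
      h.comp (tendsto_id.atTop_mul_const (by positivity : (0 : ℝ) < k + 1))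
    simpa using (tendsto_finsetSum Finset.univ fun k _ => hk k).const_mul K
  rw [← norm_le_zero_iff]
  refine ge_of_tendsto hlim ?_
  filter_upwards [eventually_ge_atTop 1] with T hT
  have hT0 : 0 < T := one_pos.trans_le hT
  calc ‖c j‖ ≤ T ^ M * (T ^ j * ‖c j‖) := by
        rw [← mul_assoc, ← zpow_natCast, ← zpow_add₀ hT0.ne']
        refine le_mul_of_one_le_left (norm_nonneg _) (one_le_zpow₀ hT ?_)
        linarith [(Finset.mem_Icc.1 hj).1]
    _ ≤ T ^ M * (K * ∑ k : Fin (2 * M + 1), ‖laurentSum M c (T * (k + 1))‖) := by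
        exact mul_le_mul_of_nonneg_left (hbound c T hT0 j hj) (pow_nonneg hT0.le M)
    _ = K * ∑ k : Fin (2 * M + 1), T ^ M * ‖laurentSum M c (T * (k + 1))‖ := by
        rw [← Finset.mul_sum]
        ring
    _ ≤ _ := by
        gcongr with k
        exact le_mul_of_one_le_right hT0.le (le_add_of_nonneg_left (Nat.cast_nonneg _))

/-! ### Uniqueness of Fourier expansions -/

namespace IsFourierExpansion

variable {f : ℍ → ℂ} {M N M' N' : ℕ} {A B : ℤ → ℤ → ℤ → ℂ}

lemma norm_lineCoeff_le_of_forall_lt_eq_zero (h : IsFourierExpansion (fun _ => 0) M N A)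
    {m n : ℤ} (hlow : ∀ j n', n' < n → A j (m - n + n') n' = 0) {y : ℝ} (hy : 1 ≤ y) :
    ‖lineCoeff M A y (m, n)‖ ≤ Real.exp (-(2 * Real.pi * (m + n + 2) * (y - 1))) * y ^ M *
      ∑' p : ℤ × ℤ, ∑ j ∈ Finset.Icc (-(M : ℤ)) (M : ℤ),
        ‖A j p.1 p.2‖ * Real.exp (-(2 * Real.pi * (p.1 + p.2) * 1)) := by
  have hsum := h.hasSum_lineCoeff (one_pos.trans_le hy) (m - n)
  simp only [zero_mul, intervalIntegral.integral_zero] at hsum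
  have hsplit := hsum.summable.tsum_eq_add_tsum_ite (m, n)
  rw [hsum.tsum_eq, if_pos rfl] at hsplit
  rw [eq_neg_of_add_eq_zero_left hsplit.symm, norm_neg, ← tsum_mul_left]
  refine tsum_of_norm_bounded (Summable.hasSum <| Summable.mul_left _ <|
    summable_sum fun j _ => (h.isConvergent j).summable_norm_mul_exp one_pos) fun p => ?_
  have : 0 < y := one_pos.trans_le hy
  split_ifs with hp hpl
  · rw [norm_zero]
    positivity
  · rcases lt_or_ge p.2 n with hlt | hge
    · have hz : ∀ j, A j p.1 p.2 = 0 := fun j => by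
        have := hlow j p.2 hlt
        rwa [← hpl, sub_add_cancel] at this
      simp [lineCoeff, laurentSum, hz]
    · have hne : p.2 ≠ n := fun h3 => hp (Prod.ext (by omega) h3)
      refine norm_lineCoeff_le_of_le_add M A hy ?_
      exact_mod_cast (by omega : m + n + 2 ≤ p.1 + p.2)
  · rw [norm_zero]
    positivity

/-- On the diagonal of `(m, n)` the remaining terms are smaller by a factor `exp (-4 π y)`. -/
lemma coeff_eq_zero_of_forall_lt_eq_zero (h : IsFourierExpansion (fun _ => 0) M N A) {m n : ℤ}
    (hlow : ∀ j n', n' < n → A j (m - n + n') n' = 0) (j : ℤ) : A j m n = 0 := by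
  by_cases hj : j ∈ Finset.Icc (-(M : ℤ)) (M : ℤ)
  swap
  · exact h.coeff_eq_zero hj m n
  set S := ∑' p : ℤ × ℤ, ∑ j ∈ Finset.Icc (-(M : ℤ)) (M : ℤ),
    ‖A j p.1 p.2‖ * Real.exp (-(2 * Real.pi * (p.1 + p.2) * 1))
  have hbound : ∀ y : ℝ, 1 ≤ y → y ^ M * ‖laurentSum M (fun j => A j m n) y‖ ≤
      Real.exp (2 * Real.pi * (m + n + 2)) * S *
        (y ^ (2 * M) * Real.exp (-(4 * Real.pi) * y)) := by
    intro y hy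
    have hline := h.norm_lineCoeff_le_of_forall_lt_eq_zero hlow hy
    rw [norm_lineCoeff, ← le_div_iff₀ (Real.exp_pos _), div_eq_mul_inv, ← Real.exp_neg] at hline
    refine (mul_le_mul_of_nonneg_left hline (pow_nonneg (zero_le_one.trans hy) M)).trans_eq ?_
    have hexp : Real.exp (-(2 * Real.pi * (m + n + 2) * (y - 1))) *
        Real.exp (- -(2 * Real.pi * (m + n) * y)) =
        Real.exp (2 * Real.pi * (m + n + 2)) * Real.exp (-(4 * Real.pi) * y) := by
      rw [← Real.exp_add, ← Real.exp_add]
      ring_nf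
    linear_combination (y ^ M * y ^ M * S) * hexp
  have hdecay := tendsto_rpow_mul_exp_neg_mul_atTop_nhds_zero ((2 * M : ℕ) : ℝ) (4 * Real.pi)
    (by positivity)
  simp only [Real.rpow_natCast] at hdecay
  refine coeff_eq_zero_of_tendsto_laurentSum (c := fun j => A j m n) (squeeze_zero' ?_ ?_
    (by simpa only [mul_zero] using hdecay.const_mul (Real.exp (2 * Real.pi * (m + n + 2)) * S))) hj
  · filter_upwards [eventually_ge_atTop 1] with y hy
    have := one_pos.trans_le hy
    positivity
  · filter_upwards [eventually_ge_atTop 1] using hbound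

theorem eq_zero (h : IsFourierExpansion (fun _ => 0) M N A) (j m n : ℤ) : A j m n = 0 := by
  have hrow : ∀ (k : ℕ) (l j n : ℤ), n < -(N : ℤ) + k → A j (l + n) n = 0 := by
    intro k
    induction k with
    | zero => exact fun l j n hn => h.support j _ n (Or.inr (Or.inr (by simpa using hn)))
    | succ k ih =>
      intro l j n hn
      refine h.coeff_eq_zero_of_forall_lt_eq_zero (fun j' n' hn' => ?_) j
      rw [add_sub_cancel_right]
      exact ih l j' n' (by omega)
  have := hrow (n + N + 1).toNat (m - n) j n (by omega)
  rwa [sub_add_cancel] at this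

theorem unique (h : IsFourierExpansion f M N A) (h' : IsFourierExpansion f M' N' B) : A = B := by
  have hsub : IsFourierExpansion (fun _ => 0) (max M M') (max N N')
      fun j m n => A j m n + -1 * B j m n := by
    convert (h.mono (le_max_left M M') (le_max_left N N')).add
      ((h'.mono (le_max_right M M') (le_max_right N N')).const_mul (-1)) using 1
    funext z
    ring
  funext j m n
  linear_combination hsub.eq_zero j m n

end IsFourierExpansion

/-! ### The recursion satisfied by the coefficients of a solution of `Δ f = lam f` -/

/-- The recursion in the exponent `j` of `y` satisfied by the Fourier coefficients of a solution
of `Δ_{r, s} f = lam f`, for coefficients supported on finitely many exponents. -/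
structure IsEigenRecursion (r s : ℤ) (lam : ℂ) (A : ℤ → ℤ → ℤ → ℂ) : Prop where
  bounded : ∃ M : ℤ, ∀ j m n : ℤ, A j m n ≠ 0 → -M ≤ j ∧ j ≤ M
  rec_eq : ∀ j m n : ℤ, (-(j * (j + r + s - 1)) - lam) * A j m n
        + 4 * Real.pi * (n * (j - 1 + r) + m * (j - 1 + s)) * A (j - 1) m n
        - 16 * Real.pi ^ 2 * m * n * A (j - 2) m n = 0

lemma IsFourierExpansion.isEigenRecursion {f : ℍ → ℂ} {M N : ℕ} {A : ℤ → ℤ → ℤ → ℂ} {r s : ℤ}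
    {lam : ℂ} (h : IsFourierExpansion f M N A) (hf : ∀ z, laplacian r s f z = lam * f z) :
    IsEigenRecursion r s lam A where
  bounded := by
    refine ⟨M, fun j m n hA => ?_⟩
    by_contra hj
    exact hA (h.coeff_eq_zero (by rwa [Finset.mem_Icc]) m n)
  rec_eq := by
    have hzero := h.laplacian_sub_mul r s lam
    simp only [hf, sub_self] at hzero
    exact hzero.eq_zero

namespace IsEigenRecursion

variable {r s : ℤ} {lam : ℂ} {A : ℤ → ℤ → ℤ → ℂ}

lemma swap (h : IsEigenRecursion r s lam A) : IsEigenRecursion s r lam fun j m n => A j n m where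
  bounded := h.bounded.imp fun _ hM j m n => hM j n m
  rec_eq j m n := by linear_combination h.rec_eq j n m

lemma exists_lowest (h : IsEigenRecursion r s lam A) {j m n : ℤ} (hA : A j m n ≠ 0) :
    ∃ i ≤ j, lam = ((i * (1 - r - s - i) : ℤ) : ℂ) := by
  obtain ⟨M, hM⟩ := h.bounded
  obtain ⟨i, hi, hmin⟩ := Int.exists_least_of_bdd (P := fun i => A i m n ≠ 0)
    ⟨-M, fun i hi => (hM i m n hi).1⟩ ⟨j, hA⟩
  have hbelow : ∀ i' < i, A i' m n = 0 := fun i' hi' => by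
    by_contra hne
    exact hi'.not_ge (hmin i' hne)
  have hrec := h.rec_eq i m n
  rw [hbelow (i - 1) (by omega), hbelow (i - 2) (by omega), mul_zero, mul_zero, add_zero,
    sub_zero] at hrec
  refine ⟨i, hmin j hA, ?_⟩
  push_cast
  linear_combination -(mul_eq_zero.1 hrec).resolve_right hi

lemma exists_highest (h : IsEigenRecursion r s lam A) {j m n : ℤ} (hA : A j m n ≠ 0) :
    ∃ i, j ≤ i ∧ A i m n ≠ 0 ∧ ∀ i', i < i' → A i' m n = 0 := by
  obtain ⟨M, hM⟩ := h.bounded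
  obtain ⟨i, hi, hmax⟩ := Int.exists_greatest_of_bdd (P := fun i => A i m n ≠ 0)
    ⟨M, fun i hi => (hM i m n hi).2⟩ ⟨j, hA⟩
  refine ⟨i, hmax j hA, hi, fun i' hi' => ?_⟩
  by_contra hne
  exact hi'.not_ge (hmax i' hne)

lemma eq_zero_or_eq_zero (h : IsEigenRecursion r s lam A) {j m n : ℤ} (hA : A j m n ≠ 0) :
    m = 0 ∨ n = 0 := by
  obtain ⟨i, -, hi, habove⟩ := h.exists_highest hA
  have hrec := h.rec_eq (i + 2) m n
  rw [habove (i + 2) (by omega), habove (i + 2 - 1) (by omega), add_sub_cancel_right] at hrec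
  simpa [hi, Real.pi_ne_zero] using hrec

lemma le_neg_of_right_eq_zero (h : IsEigenRecursion r s lam A) {j m : ℤ} (hm : m ≠ 0)
    (hA : A j m 0 ≠ 0) : j ≤ -s := by
  obtain ⟨i, hji, hi, habove⟩ := h.exists_highest hA
  have hrec := h.rec_eq (i + 1) m 0
  rw [habove (i + 1) (by omega), add_sub_cancel_right] at hrec
  have hfactor : (4 * Real.pi * m * A i m 0 : ℂ) * ((i + s : ℤ) : ℂ) = 0 := by
    push_cast at hrec ⊢
    linear_combination hrec
  have his : i + s = 0 := by simpa [hi, hm, Real.pi_ne_zero, ← Int.cast_add] using hfactor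
  omega

lemma le_neg_of_left_eq_zero (h : IsEigenRecursion r s lam A) {j n : ℤ} (hn : n ≠ 0)
    (hA : A j 0 n ≠ 0) : j ≤ -r :=
  h.swap.le_neg_of_right_eq_zero hn hA

lemma eq_root (h : IsEigenRecursion r s lam A) {j : ℤ} (hA : A j 0 0 ≠ 0) :
    lam = ((j * (1 - r - s - j) : ℤ) : ℂ) := by
  have hrec := h.rec_eq j 0 0
  simp only [Int.cast_zero, zero_mul, mul_zero, add_zero, sub_zero] at hrec
  push_cast
  linear_combination -(mul_eq_zero.1 hrec).resolve_right hA

end IsEigenRecursion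

lemma eq_or_eq_of_indicial {r s k₀ i : ℤ} (h : i * (1 - r - s - i) = k₀ * (1 - r - s - k₀)) :
    i = k₀ ∨ i = 1 - r - s - k₀ := by
  have hprod : (i - k₀) * (i - (1 - r - s - k₀)) = 0 := by linear_combination -h
  exact (mul_eq_zero.1 hprod).imp sub_eq_zero.1 sub_eq_zero.1

lemma autFactor_neg_one (z : ℂ) : autFactor (-1) z = -1 := by
  simp [autFactor]

lemma IsModularForm.even_sub {r s : ℤ} {f : ℍ → ℂ} (hf : IsModularForm r s f) (h0 : f ≠ 0) :
    Even (r - s) := by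
  obtain ⟨z, hz⟩ := Function.ne_iff.1 h0
  have hneg := hf.modular (-1) z
  rw [ModularGroup.SL_neg_smul, one_smul, autFactor_neg_one, autFactor_neg_one,
    ← zpow_add₀ (neg_ne_zero.2 one_ne_zero)] at hneg
  have hsign : (-1 : ℂ) ^ (r + s) = 1 := mul_right_cancel₀ hz (by rw [← hneg, one_mul])
  rw [Int.even_sub, ← Int.even_add]
  by_contra hodd
  rw [(Int.not_even_iff_odd.1 hodd).neg_one_zpow] at hsign
  norm_num at hsign

lemma IsModularForm.exists_root {r s : ℤ} {lam : ℂ} {f : ℍ → ℂ} (hf : IsModularForm r s f)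
    (hΔ : ∀ z, laplacian r s f z = lam * f z) (h0 : f ≠ 0) :
    ∃ k₀ : ℤ, k₀ < 1 - r - s - k₀ ∧ lam = ((k₀ * (1 - r - s - k₀) : ℤ) : ℂ) := by
  obtain ⟨M, N, A, hA⟩ := hf.expansion
  obtain ⟨j, m, n, hne⟩ : ∃ j m n, A j m n ≠ 0 := by
    by_contra! hall
    exact h0 (funext fun z => by simp [hA.eq z, hall])
  obtain ⟨i, -, hi⟩ := (hA.isEigenRecursion hΔ).exists_lowest hne
  obtain ⟨t, ht⟩ := hf.even_sub h0
  rcases lt_or_ge i (1 - r - s - i) with h | h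
  · exact ⟨i, h, hi⟩
  · exact ⟨1 - r - s - i, by omega, by rw [hi]; push_cast; ring⟩

/-! ### Comparison of the two kinds of expansions -/

lemma hasSum_ite_snd_eq {ι κ E : Type*} [DecidableEq κ] [AddCommMonoid E] [TopologicalSpace E]
    {g : ι → E} {a : E} (h : HasSum g a) (k : κ) :
    HasSum (fun p : ι × κ => if p.2 = k then g p.1 else 0) a := by
  refine ((Prod.mk_left_injective k).hasSum_iff fun p hp => if_neg fun hk => hp ⟨p.1, ?_⟩).1
    (by simpa [Function.comp_def] using h)
  rw [← hk]

lemma hasSum_ite_fst_eq {ι κ E : Type*} [DecidableEq ι] [AddCommMonoid E] [TopologicalSpace E]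
    {g : κ → E} {a : E} (h : HasSum g a) (i : ι) :
    HasSum (fun p : ι × κ => if p.1 = i then g p.2 else 0) a :=
  (Equiv.prodComm ι κ).hasSum_iff.2 (hasSum_ite_snd_eq h i)

namespace EigenCoeffs

/-- The coefficient of `y ^ j` in the constant term `α y ^ k₀ + β y ^ (1 - r - s - k₀)`. -/
def constCoeff (E : EigenCoeffs) (r s k₀ j : ℤ) : ℂ :=
  (if j = k₀ then E.α else 0) + (if j = 1 - r - s - k₀ then E.β else 0)

/-- The coefficient of `y ^ j * q ^ m * (conj q) ^ n` in the expansion with coefficients `E`. -/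
def doubleCoeff (E : EigenCoeffs) (r s k₀ j m n : ℤ) : ℂ :=
  (if m = 0 ∧ n = 0 then E.constCoeff r s k₀ j else 0)
    + (if n = 0 then E.a j m else 0) + (if m = 0 then E.b j n else 0)

variable {r s k₀ : ℤ} {E : EigenCoeffs}

lemma hasSum_zpow_mul_constCoeff (E : EigenCoeffs) (r s k₀ : ℤ) (y : ℂ) :
    HasSum (fun j => y ^ j * E.constCoeff r s k₀ j)
      (E.α * y ^ k₀ + E.β * y ^ (1 - r - s - k₀)) := by
  refine ((hasSum_ite_eq k₀ _).add (hasSum_ite_eq (1 - r - s - k₀) _)).congr_fun fun j => ?_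
  rw [constCoeff, mul_add, mul_ite, mul_ite, mul_zero]
  congr 1 <;> split_ifs with h <;> simp only [h, mul_comm]

lemma hasSum_doubleCoeff {j : ℤ} {z : ℂ} (ha : Summable fun m : ℤ => E.a j m * nome z ^ m)
    (hb : Summable fun m : ℤ => E.b j m * conj (nome z) ^ m) :
    HasSum (fun p : ℤ × ℤ => E.doubleCoeff r s k₀ j p.1 p.2 * nomeMonomial p.1 p.2 z)
      (E.constCoeff r s k₀ j + ∑' m : ℤ, E.a j m * nome z ^ m
        + ∑' m : ℤ, E.b j m * conj (nome z) ^ m) := by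
  refine (((hasSum_ite_eq ((0, 0) : ℤ × ℤ) (E.constCoeff r s k₀ j)).add
    (hasSum_ite_snd_eq ha.hasSum 0)).add (hasSum_ite_fst_eq hb.hasSum 0)).congr_fun fun p => ?_
  obtain ⟨m, n⟩ := p
  by_cases hm : m = 0 <;> by_cases hn : n = 0 <;>
    simp [doubleCoeff, nomeMonomial, hm, hn]

lemma doubleCoeff_eq_zero {j m n : ℤ} (h : ¬(m = 0 ∧ n = 0 ∧ (j = k₀ ∨ j = 1 - r - s - k₀)))
    (ha : n = 0 → E.a j m = 0) (hb : m = 0 → E.b j n = 0) : E.doubleCoeff r s k₀ j m n = 0 := by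
  rw [doubleCoeff, constCoeff, ite_eq_right_iff.2 ha, ite_eq_right_iff.2 hb]
  split_ifs <;> simp_all

lemma doubleCoeff_of_left_ne_zero {j m : ℤ} (hm : m ≠ 0) :
    E.doubleCoeff r s k₀ j m 0 = E.a j m := by
  simp [doubleCoeff, hm]

lemma doubleCoeff_of_right_ne_zero {j n : ℤ} (hn : n ≠ 0) :
    E.doubleCoeff r s k₀ j 0 n = E.b j n := by
  simp [doubleCoeff, hn]

lemma hasSum_doubleSeries (ha0 : ∀ j m : ℤ, (j < k₀ ∨ -s < j) → E.a j m = 0)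
    (hb0 : ∀ j m : ℤ, (j < k₀ ∨ -r < j) → E.b j m = 0) {z : ℍ}
    (ha : ∀ j : ℤ, Summable fun m : ℤ => E.a j m * nome (z : ℂ) ^ m)
    (hb : ∀ j : ℤ, Summable fun m : ℤ => E.b j m * conj (nome (z : ℂ)) ^ m) :
    HasSum (fun j : ℤ => (z.im : ℂ) ^ j *
        doubleSeries (fun p => E.doubleCoeff r s k₀ j p.1 p.2) z)
      ((E.α * (z.im : ℂ) ^ k₀ + E.β * (z.im : ℂ) ^ (1 - r - s - k₀))
      + ∑ j ∈ Finset.Icc k₀ (-s), (z.im : ℂ) ^ j * ∑' m : ℤ, E.a j m * nome (z : ℂ) ^ m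
      + ∑ j ∈ Finset.Icc k₀ (-r), (z.im : ℂ) ^ j *
          ∑' m : ℤ, E.b j m * conj (nome (z : ℂ)) ^ m) := by
  have hsum_a : HasSum (fun j : ℤ => (z.im : ℂ) ^ j * ∑' m : ℤ, E.a j m * nome (z : ℂ) ^ m)
      (∑ j ∈ Finset.Icc k₀ (-s), (z.im : ℂ) ^ j * ∑' m : ℤ, E.a j m * nome (z : ℂ) ^ m) :=
    hasSum_sum_of_ne_finset_zero fun j hj => by
      have : ∀ m, E.a j m = 0 := fun m => ha0 j m (by rw [Finset.mem_Icc] at hj; omega)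
      simp [this]
  have hsum_b : HasSum
      (fun j : ℤ => (z.im : ℂ) ^ j * ∑' m : ℤ, E.b j m * conj (nome (z : ℂ)) ^ m)
      (∑ j ∈ Finset.Icc k₀ (-r), (z.im : ℂ) ^ j *
        ∑' m : ℤ, E.b j m * conj (nome (z : ℂ)) ^ m) :=
    hasSum_sum_of_ne_finset_zero fun j hj => by
      have : ∀ m, E.b j m = 0 := fun m => hb0 j m (by rw [Finset.mem_Icc] at hj; omega)
      simp [this]
  refine (((E.hasSum_zpow_mul_constCoeff r s k₀ z.im).add hsum_a).add hsum_b).congr_fun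
    fun j => ?_
  rw [doubleSeries, (hasSum_doubleCoeff (ha j) (hb j)).tsum_eq, mul_add, mul_add]

end EigenCoeffs

namespace IsEigenExpansion

variable {r s k₀ : ℤ} {f : ℍ → ℂ} {E E' : EigenCoeffs}

lemma a_eq_zero (h : IsEigenExpansion r s k₀ f E) {j m : ℤ} (hj : j < k₀ ∨ -s < j ∨ m = 0) :
    E.a j m = 0 := by
  obtain ⟨N, hN⟩ := h.support_a
  exact hN j m (by tauto)

lemma b_eq_zero (h : IsEigenExpansion r s k₀ f E) {j m : ℤ} (hj : j < k₀ ∨ -r < j ∨ m = 0) :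
    E.b j m = 0 := by
  obtain ⟨N, hN⟩ := h.support_b
  exact hN j m (by tauto)

theorem isFourierExpansion (h : IsEigenExpansion r s k₀ f E) :
    ∃ M N : ℕ, IsFourierExpansion f M N (E.doubleCoeff r s k₀) := by
  obtain ⟨N₁, hN₁⟩ := h.support_a
  obtain ⟨N₂, hN₂⟩ := h.support_b
  refine ⟨k₀.natAbs + (1 - r - s - k₀).natAbs + r.natAbs + s.natAbs, N₁ + N₂, ?_⟩
  have hsupp : ∀ j m n : ℤ,
      (((k₀.natAbs + (1 - r - s - k₀).natAbs + r.natAbs + s.natAbs : ℕ) : ℤ) < |j| ∨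
        m < -((N₁ + N₂ : ℕ) : ℤ) ∨ n < -((N₁ + N₂ : ℕ) : ℤ)) →
      E.doubleCoeff r s k₀ j m n = 0 := by
    intro j m n hjmn
    rw [Int.abs_eq_natAbs] at hjmn
    refine EigenCoeffs.doubleCoeff_eq_zero (by omega) (fun hn => hN₁ j m ?_)
      (fun hm => hN₂ j n ?_) <;> omega
  refine IsFourierExpansion.of_hasSum hsupp (fun j => ⟨fun p hp => hsupp j p.1 p.2 (Or.inr hp),
    fun z => (EigenCoeffs.hasSum_doubleCoeff (h.summable_a j z) (h.summable_b j z)).summable⟩)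
    fun z => ?_
  rw [h.eq z]
  exact EigenCoeffs.hasSum_doubleSeries (fun j m hj => h.a_eq_zero (by tauto))
    (fun j m hj => h.b_eq_zero (by tauto)) (fun j => h.summable_a j z) (fun j => h.summable_b j z)

theorem eq_doubleCoeff (h : IsEigenExpansion r s k₀ f E) {M N : ℕ} {A : ℤ → ℤ → ℤ → ℂ}
    (hA : IsFourierExpansion f M N A) : A = E.doubleCoeff r s k₀ := by
  obtain ⟨M', N', h'⟩ := h.isFourierExpansion
  exact hA.unique h'

lemma doubleCoeff_zero (h : IsEigenExpansion r s k₀ f E) (j : ℤ) :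
    E.doubleCoeff r s k₀ j 0 0 = E.constCoeff r s k₀ j := by
  simp [EigenCoeffs.doubleCoeff, h.a_eq_zero, h.b_eq_zero]

theorem unique (hk : k₀ < 1 - r - s - k₀) (h : IsEigenExpansion r s k₀ f E)
    (h' : IsEigenExpansion r s k₀ f E') : E = E' := by
  obtain ⟨M, N, hA⟩ := h.isFourierExpansion
  have heq : ∀ j m n, E.doubleCoeff r s k₀ j m n = E'.doubleCoeff r s k₀ j m n := fun j m n => by
    rw [← h'.eq_doubleCoeff hA]
  have hconst : ∀ j, E.constCoeff r s k₀ j = E'.constCoeff r s k₀ j := fun j => by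
    rw [← h.doubleCoeff_zero, ← h'.doubleCoeff_zero, heq]
  have hα : E.α = E'.α := by simpa [EigenCoeffs.constCoeff, hk.ne] using hconst k₀
  have hβ : E.β = E'.β := by
    simpa [EigenCoeffs.constCoeff, hk.ne'] using hconst (1 - r - s - k₀)
  have ha : E.a = E'.a := by
    funext j m
    by_cases hm : m = 0
    · rw [h.a_eq_zero (by tauto), h'.a_eq_zero (by tauto)]
    · rw [← EigenCoeffs.doubleCoeff_of_left_ne_zero hm, heq,
        EigenCoeffs.doubleCoeff_of_left_ne_zero hm]
  have hb : E.b = E'.b := by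
    funext j m
    by_cases hm : m = 0
    · rw [h.b_eq_zero (by tauto), h'.b_eq_zero (by tauto)]
    · rw [← EigenCoeffs.doubleCoeff_of_right_ne_zero hm, heq,
        EigenCoeffs.doubleCoeff_of_right_ne_zero hm]
  cases E
  cases E'
  simp_all only

end IsEigenExpansion

/-- The coefficients `α, β, a, b` read off from the Fourier coefficients `A` of an eigenform; the
entries `a j 0` and `b j 0` vanish since the constant term is recorded in `α` and `β`. -/
def EigenCoeffs.ofDouble (r s k₀ : ℤ) (A : ℤ → ℤ → ℤ → ℂ) : EigenCoeffs where
  α := A k₀ 0 0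
  β := A (1 - r - s - k₀) 0 0
  a j m := if m = 0 then 0 else A j m 0
  b j n := if n = 0 then 0 else A j 0 n

namespace IsEigenRecursion

variable {r s k₀ : ℤ} {A : ℤ → ℤ → ℤ → ℂ}

lemma le_of_ne_zero (hrec : IsEigenRecursion r s ((k₀ * (1 - r - s - k₀) : ℤ) : ℂ) A)
    (hk : k₀ < 1 - r - s - k₀) {j m n : ℤ} (hA : A j m n ≠ 0) : k₀ ≤ j := by
  obtain ⟨i, hij, hi⟩ := hrec.exists_lowest hA
  have := eq_or_eq_of_indicial (i := i) (by exact_mod_cast hi.symm)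
  omega

lemma constCoeff_ofDouble (hrec : IsEigenRecursion r s ((k₀ * (1 - r - s - k₀) : ℤ) : ℂ) A)
    (hk : k₀ < 1 - r - s - k₀) (j : ℤ) :
    (EigenCoeffs.ofDouble r s k₀ A).constCoeff r s k₀ j = A j 0 0 := by
  by_cases hroot : j = k₀ ∨ j = 1 - r - s - k₀
  · rcases hroot with rfl | rfl
    · simp [EigenCoeffs.constCoeff, EigenCoeffs.ofDouble, hk.ne]
    · simp [EigenCoeffs.constCoeff, EigenCoeffs.ofDouble, hk.ne']
  · have hA : A j 0 0 = 0 := by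
      by_contra hne
      exact hroot (eq_or_eq_of_indicial (by exact_mod_cast (hrec.eq_root hne).symm))
    rw [not_or] at hroot
    simp [EigenCoeffs.constCoeff, hroot, hA]

lemma doubleCoeff_ofDouble (hrec : IsEigenRecursion r s ((k₀ * (1 - r - s - k₀) : ℤ) : ℂ) A)
    (hk : k₀ < 1 - r - s - k₀) (j m n : ℤ) :
    (EigenCoeffs.ofDouble r s k₀ A).doubleCoeff r s k₀ j m n = A j m n := by
  rw [EigenCoeffs.doubleCoeff, hrec.constCoeff_ofDouble hk]
  by_cases hm : m = 0 <;> by_cases hn : n = 0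
  · simp [EigenCoeffs.ofDouble, hm, hn]
  · simp [EigenCoeffs.ofDouble, hm, hn]
  · simp [EigenCoeffs.ofDouble, hm, hn]
  · have hA : A j m n = 0 := by
      by_contra hne
      exact (hrec.eq_zero_or_eq_zero hne).elim hm hn
    simp [hm, hn, hA]

end IsEigenRecursion

namespace IsFourierExpansion

variable {f : ℍ → ℂ} {M N : ℕ} {A : ℤ → ℤ → ℤ → ℂ}

lemma summable_ofDouble_a (h : IsFourierExpansion f M N A) (r s k₀ j : ℤ) (z : ℍ) :
    Summable fun m : ℤ => (EigenCoeffs.ofDouble r s k₀ A).a j m * nome (z : ℂ) ^ m := by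
  refine (((h.summable j z).comp_injective (Prod.mk_left_injective 0)).indicator {0}ᶜ).congr
    fun m => ?_
  by_cases hm : m = 0 <;> simp [EigenCoeffs.ofDouble, nomeMonomial_zero_right, hm]

lemma summable_ofDouble_b (h : IsFourierExpansion f M N A) (r s k₀ j : ℤ) (z : ℍ) :
    Summable fun m : ℤ => (EigenCoeffs.ofDouble r s k₀ A).b j m * conj (nome (z : ℂ)) ^ m := by
  refine (((h.summable j z).comp_injective (Prod.mk_right_injective 0)).indicator {0}ᶜ).congr
    fun m => ?_
  by_cases hm : m = 0 <;> simp [EigenCoeffs.ofDouble, nomeMonomial_zero_left, hm]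

theorem isEigenExpansion {r s k₀ : ℤ} (h : IsFourierExpansion f M N A)
    (hk : k₀ < 1 - r - s - k₀)
    (hrec : IsEigenRecursion r s ((k₀ * (1 - r - s - k₀) : ℤ) : ℂ) A) :
    IsEigenExpansion r s k₀ f (EigenCoeffs.ofDouble r s k₀ A) := by
  have hsupp_a : ∀ j m : ℤ, (j < k₀ ∨ -s < j ∨ m < -(N : ℤ) ∨ m = 0) →
      (EigenCoeffs.ofDouble r s k₀ A).a j m = 0 := by
    intro j m hjm
    refine ite_eq_left_iff.2 fun hm => ?_
    by_contra hne
    have hlow := hrec.le_of_ne_zero hk hne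
    have hhigh := hrec.le_neg_of_right_eq_zero hm hne
    have hN : ¬m < -(N : ℤ) := fun hN => hne (h.support j m 0 (Or.inr (Or.inl hN)))
    omega
  have hsupp_b : ∀ j m : ℤ, (j < k₀ ∨ -r < j ∨ m < -(N : ℤ) ∨ m = 0) →
      (EigenCoeffs.ofDouble r s k₀ A).b j m = 0 := by
    intro j m hjm
    refine ite_eq_left_iff.2 fun hm => ?_
    by_contra hne
    have hlow := hrec.le_of_ne_zero hk hne
    have hhigh := hrec.le_neg_of_left_eq_zero hm hne
    have hN : ¬m < -(N : ℤ) := fun hN => hne (h.support j 0 m (Or.inr (Or.inr hN)))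
    omega
  have ha := h.summable_ofDouble_a r s k₀
  have hb := h.summable_ofDouble_b r s k₀
  refine ⟨⟨N, hsupp_a⟩, ⟨N, hsupp_b⟩, ha, hb, fun z => ?_⟩
  have hsum := EigenCoeffs.hasSum_doubleSeries (fun j m hj => hsupp_a j m (by tauto))
    (fun j m hj => hsupp_b j m (by tauto)) (fun j => ha j z) (fun j => hb j z)
  simp only [hrec.doubleCoeff_ofDouble hk] at hsum
  exact (h.hasSum z).unique hsum

theorem existsUnique_isEigenExpansion {r s k₀ : ℤ} (h : IsFourierExpansion f M N A)
    (hΔ : ∀ z, laplacian r s f z = ((k₀ * (1 - r - s - k₀) : ℤ) : ℂ) * f z)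
    (hk : k₀ < 1 - r - s - k₀) : ∃! E : EigenCoeffs, IsEigenExpansion r s k₀ f E :=
  have hE := h.isEigenExpansion hk (h.isEigenRecursion hΔ)
  ⟨_, hE, fun _ h' => h'.unique hk hE⟩

end IsFourierExpansion

/-! ### Growth of the coefficients -/

lemma autFactor_conj (γ : Matrix.SpecialLinearGroup (Fin 2) ℤ) (z : ℂ) :
    autFactor γ (conj z) = conj (autFactor γ z) := by
  simp [autFactor]

lemma im_le_norm_autFactor (γ : Matrix.SpecialLinearGroup (Fin 2) ℤ) {z : ℍ} (hz : z.im ≤ 1) :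
    z.im ≤ ‖autFactor γ (z : ℂ)‖ := by
  by_cases hc : γ 1 0 = 0
  · have hd : γ 1 1 ≠ 0 := by
      intro hd
      have hdet := γ.det_coe
      rw [Matrix.det_fin_two, hc, hd, mul_zero, mul_zero, sub_zero] at hdet
      exact zero_ne_one hdet
    rw [autFactor, hc, Int.cast_zero, zero_mul, zero_add, Complex.norm_intCast]
    exact hz.trans (by exact_mod_cast Int.one_le_abs hd)
  · calc z.im ≤ |(γ 1 0 : ℝ)| * z.im :=
          le_mul_of_one_le_left z.im_pos.le (by exact_mod_cast Int.one_le_abs hc)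
      _ = |(autFactor γ (z : ℂ)).im| := by
          rw [← abs_of_pos z.im_pos, ← abs_mul]
          simp [autFactor]
      _ ≤ ‖autFactor γ (z : ℂ)‖ := Complex.abs_im_le_norm _

lemma im_smul_eq (γ : Matrix.SpecialLinearGroup (Fin 2) ℤ) (z : ℍ) :
    (γ • z).im = z.im / ‖autFactor γ (z : ℂ)‖ ^ 2 := by
  rw [ModularGroup.im_smul_eq_div_normSq, ModularGroup.denom_apply, Complex.normSq_eq_norm_sq]
  rfl

lemma norm_autFactor_le_two {γ : Matrix.SpecialLinearGroup (Fin 2) ℤ} {z : ℍ} (hz : z.im ≤ 1)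
    (him : 1 / 2 ≤ (γ • z).im) : ‖autFactor γ (z : ℂ)‖ ≤ 2 := by
  have hpos : 0 < ‖autFactor γ (z : ℂ)‖ := z.im_pos.trans_le (im_le_norm_autFactor γ hz)
  rw [im_smul_eq, le_div_iff₀ (by positivity)] at him
  nlinarith

lemma im_smul_le_one_div (γ : Matrix.SpecialLinearGroup (Fin 2) ℤ) {z : ℍ} (hz : z.im ≤ 1) :
    (γ • z).im ≤ 1 / z.im := by
  have hle := im_le_norm_autFactor γ hz
  have hy := z.im_pos
  rw [im_smul_eq, div_le_div_iff₀ (by nlinarith) hy]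
  nlinarith

lemma zpow_le_exp_div {d y : ℝ} (hy : 0 < y) (hy1 : y ≤ 1) (hyd : y ≤ d) (hd : d ≤ 2) (k : ℤ) :
    d ^ k ≤ Real.exp (|(k : ℝ)| / y) := by
  have hd0 : 0 < d := hy.trans_le hyd
  have hone : 1 ≤ 1 / y := (one_le_div hy).2 hy1
  have hlog : |Real.log d| ≤ 1 / y := by
    refine abs_le.2 ⟨?_, ?_⟩
    · have hinv : d⁻¹ ≤ 1 / y := by rw [inv_eq_one_div]; gcongr
      have := Real.log_le_sub_one_of_pos (inv_pos.2 hd0)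
      rw [Real.log_inv] at this
      linarith
    · linarith [Real.log_le_sub_one_of_pos hd0]
  rw [← Real.exp_log (zpow_pos hd0 k), Real.log_zpow, Real.exp_le_exp]
  calc k * Real.log d ≤ |(k : ℝ)| * |Real.log d| := (le_abs_self _).trans_eq (abs_mul _ _)
    _ ≤ |(k : ℝ)| * (1 / y) := by gcongr
    _ = _ := mul_one_div _ _

namespace IsModularForm

variable {r s : ℤ} {f : ℍ → ℂ}

lemma norm_smul_eq (hf : IsModularForm r s f) (γ : Matrix.SpecialLinearGroup (Fin 2) ℤ) (z : ℍ)
    (hd : autFactor γ (z : ℂ) ≠ 0) :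
    ‖f (γ • z)‖ = ‖autFactor γ (z : ℂ)‖ ^ (r + s) * ‖f z‖ := by
  rw [hf.modular, autFactor_conj, norm_mul, norm_mul, norm_zpow, norm_zpow, norm_conj,
    zpow_add₀ (norm_ne_zero_iff.2 hd)]

lemma growth_strip (hf : IsModularForm r s f) : ∃ K C : ℝ, 0 ≤ K ∧ 0 < C ∧
    ∀ w : ℍ, |w.re| ≤ 1 / 2 → 1 / 2 ≤ w.im → ‖f w‖ ≤ K * Real.exp (C * w.im) := by
  obtain ⟨C, hC, hO⟩ := hf.growth
  obtain ⟨K₀, hK₀⟩ := hO.bound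
  obtain ⟨Y, hY⟩ := (atImInfty_mem _).1 hK₀
  have hcomp : IsCompact (Set.Icc (-(1 / 2) : ℝ) (1 / 2) ×ℂ Set.Icc (1 / 2 : ℝ) Y) :=
    isCompact_Icc.reProdIm isCompact_Icc
  have hcont : ContinuousOn (f ∘ ofComplex)
      (Set.Icc (-(1 / 2) : ℝ) (1 / 2) ×ℂ Set.Icc (1 / 2 : ℝ) Y) :=
    hf.analytic.continuousOn.mono fun z hz => one_half_pos.trans_le hz.2.1
  obtain ⟨K₁, hK₁⟩ := hcomp.exists_bound_of_continuousOn hcont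
  refine ⟨|K₀| + |K₁|, C, by positivity, hC, fun w hre him => ?_⟩
  rcases le_total Y w.im with h | h
  · have htop : ‖f w‖ ≤ K₀ * ‖Real.exp (C * w.im)‖ := hY w h
    rw [Real.norm_of_nonneg (Real.exp_pos _).le] at htop
    refine htop.trans (mul_le_mul_of_nonneg_right ?_ (Real.exp_pos _).le)
    linarith [le_abs_self K₀, abs_nonneg K₁]
  · have hbox := hK₁ (w : ℂ) ⟨abs_le.1 hre, him, h⟩
    rw [Function.comp_apply, ofComplex_apply] at hbox
    refine (hbox.trans ?_).trans
      (le_mul_of_one_le_right (by positivity) (Real.one_le_exp (by positivity)))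
    linarith [le_abs_self K₁, abs_nonneg K₀]

/-- Move `z` into the fundamental domain by `γ ∈ SL(2, ℤ)`: then `y ≤ |c z + d| ≤ 2` and
`im (γ z) ≤ 1 / y`. -/
theorem growth_zero (hf : IsModularForm r s f) : ∃ K C : ℝ, 0 ≤ K ∧ 0 < C ∧
    ∀ z : ℍ, z.im ≤ 1 → ‖f z‖ ≤ K * Real.exp (C / z.im) := by
  obtain ⟨K, C, hK, hC, hstrip⟩ := hf.growth_strip
  refine ⟨K, C + |((-(r + s) : ℤ) : ℝ)|, hK, by positivity, fun z hz => ?_⟩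
  obtain ⟨γ, hγ⟩ := ModularGroup.exists_smul_mem_fd z
  have him : 1 / 2 ≤ (γ • z).im := by
    nlinarith [ModularGroup.three_le_four_mul_im_sq_of_mem_fd hγ, (γ • z).im_pos]
  have hyd := im_le_norm_autFactor γ hz
  have hd : 0 < ‖autFactor γ (z : ℂ)‖ := z.im_pos.trans_le hyd
  calc ‖f z‖ = ‖autFactor γ (z : ℂ)‖ ^ (-(r + s)) * ‖f (γ • z)‖ := by
        rw [hf.norm_smul_eq γ z (norm_pos_iff.1 hd), ← mul_assoc, ← zpow_add₀ hd.ne',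
          neg_add_cancel, zpow_zero, one_mul]
    _ ≤ Real.exp (|((-(r + s) : ℤ) : ℝ)| / z.im) * (K * Real.exp (C * (1 / z.im))) := by
        gcongr
        · exact zpow_le_exp_div z.im_pos hz hyd (norm_autFactor_le_two hz him) _
        · refine (hstrip (γ • z) hγ.2 him).trans ?_
          gcongr
          exact im_smul_le_one_div γ hz
    _ = K * Real.exp ((C + |((-(r + s) : ℤ) : ℝ)|) / z.im) := by
        rw [mul_left_comm, ← Real.exp_add]
        ring_nf

end IsModularForm

lemma div_add_sq_mul_le {C c D R x : ℝ} (hC : 0 ≤ C) (hc : 0 ≤ c) (hR : 0 < R) (hx : 1 ≤ x)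
    (hxD : x ≤ D) :
    C / ((D * R)⁻¹ * x) + c * R ^ 2 * ((D * R)⁻¹ * x) ≤ (C * D + c) * R := by
  have hx0 : 0 < x := one_pos.trans_le hx
  have hD : 0 < D := hx0.trans_le hxD
  have hfirst : C / ((D * R)⁻¹ * x) ≤ C * D * R := by
    rw [div_le_iff₀ (by positivity), show C * D * R * ((D * R)⁻¹ * x) = C * x by field_simp]
    exact le_mul_of_one_le_right hC hx
  have hsecond : c * R ^ 2 * ((D * R)⁻¹ * x) ≤ c * R := by
    rw [show c * R ^ 2 * ((D * R)⁻¹ * x) = c * R * (x / D) by field_simp]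
    exact mul_le_of_le_one_right (by positivity) ((div_le_one hD).2 hxD)
  linarith

lemma zpow_le_exp_mul {T : ℝ} (hT : 1 ≤ T) {M : ℕ} {j : ℤ} (hj : j ≤ M) :
    T ^ j ≤ Real.exp (M * T) := by
  rw [Real.exp_nat_mul]
  calc T ^ j ≤ T ^ M := by
        rw [← zpow_natCast]
        exact zpow_le_zpow_right₀ hT hj
    _ ≤ Real.exp T ^ M := by
        gcongr
        linarith [Real.add_one_le_exp T]

/-- The points of interpolation are multiples of `y = 1 / √n`, which minimizes the bound up to
constants. -/
lemma isBigO_exp_sqrt_of_norm_laurentSum_le {M : ℕ} {c : ℕ → ℤ → ℂ} {K C : ℝ} (hK : 0 ≤ K)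
    (hC : 0 ≤ C)
    (h : ∀ᶠ n : ℕ in atTop, ∀ y : ℝ, 0 < y → y ≤ 1 →
      ‖laurentSum M (c n) y‖ ≤ K * Real.exp (C / y + 2 * Real.pi * n * y))
    {j : ℤ} (hj : j ∈ Finset.Icc (-(M : ℤ)) (M : ℤ)) :
    ∃ C' : ℝ, 0 < C' ∧ (fun n : ℕ => c n j) =O[atTop] fun n : ℕ => Real.exp (C' * √(n : ℝ)) := by
  obtain ⟨K₁, hK₁, hcoeff⟩ := exists_norm_coeff_le_sum_norm_laurentSum M
  set D : ℝ := 2 * M + 1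
  have hD : 1 ≤ D := le_add_of_nonneg_left (by positivity)
  refine ⟨M * D + (C * D + 2 * Real.pi), by positivity, IsBigO.of_bound (K₁ * (D * K)) ?_⟩
  filter_upwards [h, eventually_ge_atTop 1] with n hn hn1
  have hR : 1 ≤ √(n : ℝ) := Real.one_le_sqrt.2 (by exact_mod_cast hn1)
  have hR0 : 0 < √(n : ℝ) := one_pos.trans_le hR
  have hDR : 1 ≤ D * √(n : ℝ) := one_le_mul_of_one_le_of_one_le hD hR
  have hDR0 : 0 < D * √(n : ℝ) := one_pos.trans_le hDR
  have hvalue : ∀ k : Fin (2 * M + 1), ‖laurentSum M (c n) ((D * √(n : ℝ))⁻¹ * (k + 1))‖ ≤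
      K * Real.exp ((C * D + 2 * Real.pi) * √(n : ℝ)) := by
    intro k
    have hk1 : (1 : ℝ) ≤ k + 1 := le_add_of_nonneg_left (Nat.cast_nonneg _)
    have hkD : (k + 1 : ℝ) ≤ D := by
      simp only [D]
      exact_mod_cast Nat.succ_le_of_lt k.is_lt
    have hy1 : (D * √(n : ℝ))⁻¹ * (k + 1) ≤ 1 := by
      rw [inv_mul_le_one₀ hDR0]
      exact hkD.trans (le_mul_of_one_le_right (by positivity) hR)
    refine (hn _ (by positivity) hy1).trans ?_
    gcongr
    simpa only [Real.sq_sqrt n.cast_nonneg] using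
      div_add_sq_mul_le hC Real.two_pi_pos.le hR0 hk1 hkD
  rw [Real.norm_of_nonneg (Real.exp_pos _).le]
  calc ‖c n j‖ = (D * √(n : ℝ)) ^ j * ((D * √(n : ℝ))⁻¹ ^ j * ‖c n j‖) := by
        rw [inv_zpow, mul_inv_cancel_left₀ (zpow_pos hDR0 j).ne']
    _ ≤ Real.exp (M * (D * √(n : ℝ))) * (K₁ * ∑ _k : Fin (2 * M + 1),
          K * Real.exp ((C * D + 2 * Real.pi) * √(n : ℝ))) := by
        refine mul_le_mul (zpow_le_exp_mul hDR (Finset.mem_Icc.1 hj).2)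
          ((hcoeff (c n) _ (by positivity) j hj).trans ?_) (by positivity) (Real.exp_pos _).le
        gcongr with k
        exact hvalue k
    _ = K₁ * (D * K) * Real.exp ((M * D + (C * D + 2 * Real.pi)) * √(n : ℝ)) := by
        rw [Finset.sum_const, Finset.card_univ, Fintype.card_fin, nsmul_eq_mul,
          add_mul (M * D), Real.exp_add, mul_assoc (M : ℝ)]
        simp only [D]
        push_cast
        ring

namespace IsFourierExpansion

variable {f : ℍ → ℂ} {M N : ℕ} {A : ℤ → ℤ → ℤ → ℂ}

lemma norm_laurentSum_le_of_isolated (h : IsFourierExpansion f M N A) {m n : ℤ}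
    (hiso : ∀ p : ℤ × ℤ, p ≠ (m, n) → p.1 - p.2 = m - n → ∀ j, A j p.1 p.2 = 0) {y B : ℝ}
    (hy : 0 < y) (hB : ∀ z : ℍ, z.im = y → ‖f z‖ ≤ B) :
    ‖laurentSum M (fun j => A j m n) y‖ ≤ B * Real.exp (2 * Real.pi * (m + n) * y) := by
  have hsingle := hasSum_single (f := fun p : ℤ × ℤ =>
    if p.1 - p.2 = m - n then lineCoeff M A y p else 0) (m, n) fun p hp => by
      split_ifs with hl
      · simp [lineCoeff, laurentSum, hiso p hp hl]
      · rfl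
  rw [if_pos rfl] at hsingle
  have hline : ‖lineCoeff M A y (m, n)‖ ≤ B := by
    rw [hsingle.unique (h.hasSum_lineCoeff hy (m - n))]
    refine (intervalIntegral.norm_integral_le_of_norm_le_const fun x _ => ?_).trans_eq
      (by rw [sub_zero, abs_one, mul_one])
    rw [norm_mul, norm_cexp_two_pi_I_mul, mul_one]
    exact hB _ rfl
  rwa [norm_lineCoeff, ← le_div_iff₀ (Real.exp_pos _), div_eq_mul_inv, ← Real.exp_neg,
    neg_neg] at hline

lemma isBigO_exp_sqrt (h : IsFourierExpansion f M N A) {K C : ℝ} (hK : 0 ≤ K) (hC : 0 ≤ C)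
    (hgrowth : ∀ z : ℍ, z.im ≤ 1 → ‖f z‖ ≤ K * Real.exp (C / z.im)) {m n : ℕ → ℤ}
    (hmn : ∀ k, m k + n k = k)
    (hiso : ∀ᶠ k in atTop, ∀ p : ℤ × ℤ, p ≠ (m k, n k) → p.1 - p.2 = m k - n k →
      ∀ j, A j p.1 p.2 = 0) (j : ℤ) :
    ∃ C' : ℝ, 0 < C' ∧
      (fun k : ℕ => A j (m k) (n k)) =O[atTop] fun k : ℕ => Real.exp (C' * √(k : ℝ)) := by
  refine isBigO_exp_sqrt_of_norm_laurentSum_le (M := M + j.natAbs)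
    (c := fun k j => A j (m k) (n k)) hK hC ?_ (by rw [Finset.mem_Icc]; omega)
  filter_upwards [hiso] with k hk y hy0 hy1
  have hkmn : ((m k : ℝ) + n k) = k := by exact_mod_cast hmn k
  have hle := (h.mono (Nat.le_add_right M j.natAbs) le_rfl).norm_laurentSum_le_of_isolated hk hy0
    (B := K * Real.exp (C / y)) fun z hz => hz ▸ hgrowth z (hz ▸ hy1)
  rwa [mul_assoc, ← Real.exp_add, hkmn] at hle

end IsFourierExpansion

namespace IsEigenExpansion

variable {r s k₀ : ℤ} {f : ℍ → ℂ} {E : EigenCoeffs}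

theorem isBigO_a (h : IsEigenExpansion r s k₀ f E) (hf : IsModularForm r s f) (j : ℤ) :
    ∃ C : ℝ, 0 < C ∧
      (fun n : ℕ => E.a j (n : ℤ)) =O[atTop] fun n : ℕ => Real.exp (C * √(n : ℝ)) := by
  obtain ⟨M, N, hA⟩ := h.isFourierExpansion
  obtain ⟨K, C, hK, hC, hgrowth⟩ := hf.growth_zero
  obtain ⟨N', hN'⟩ := h.support_b
  refine (hA.isBigO_exp_sqrt hK hC.le hgrowth (m := fun k => k) (n := fun _ => 0)
    (fun k => add_zero _) ?_ j).imp fun C' => And.imp_right fun hO => ?_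
  · filter_upwards [eventually_gt_atTop N'] with k hk p hne hdiag j
    have hne' : ¬(p.1 = k ∧ p.2 = 0) := fun hp => hne (Prod.ext hp.1 hp.2)
    exact EigenCoeffs.doubleCoeff_eq_zero (by omega) (by omega) fun _ => hN' _ _ (by omega)
  · refine hO.congr' ?_ .rfl
    filter_upwards [eventually_ne_atTop 0] with k hk
    exact EigenCoeffs.doubleCoeff_of_left_ne_zero (by exact_mod_cast hk)

theorem isBigO_b (h : IsEigenExpansion r s k₀ f E) (hf : IsModularForm r s f) (j : ℤ) :
    ∃ C : ℝ, 0 < C ∧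
      (fun n : ℕ => E.b j (n : ℤ)) =O[atTop] fun n : ℕ => Real.exp (C * √(n : ℝ)) := by
  obtain ⟨M, N, hA⟩ := h.isFourierExpansion
  obtain ⟨K, C, hK, hC, hgrowth⟩ := hf.growth_zero
  obtain ⟨N', hN'⟩ := h.support_a
  refine (hA.isBigO_exp_sqrt hK hC.le hgrowth (m := fun _ => 0) (n := fun k => k)
    (fun k => zero_add _) ?_ j).imp fun C' => And.imp_right fun hO => ?_
  · filter_upwards [eventually_gt_atTop N'] with k hk p hne hdiag j
    have hne' : ¬(p.1 = 0 ∧ p.2 = k) := fun hp => hne (Prod.ext hp.1 hp.2)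
    exact EigenCoeffs.doubleCoeff_eq_zero (by omega) (fun _ => hN' _ _ (by omega)) (by omega)
  · refine hO.congr' ?_ .rfl
    filter_upwards [eventually_ne_atTop 0] with k hk
    exact EigenCoeffs.doubleCoeff_of_right_ne_zero (by exact_mod_cast hk)

end IsEigenExpansion

/-! ### The Mellin transform of the exponentials -/

/-- The integrand `e ^ (-2 π l t) t ^ (w - 1)` of the Mellin transform of `q ^ m * (conj q) ^ n`
at `q = e ^ (-2 π t)`, where `l = m + n`. -/
def mellinKernel (w : ℂ) (l : ℤ) (t : ℝ) : ℂ :=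
  Real.exp (-(2 * Real.pi * l * t)) * (t : ℂ) ^ (w - 1)

/-- The value `Γ(w, 2 π l) / (2 π l) ^ w` of the integral of `mellinKernel w l` over `(1, ∞)`,
regularized for `l < 0`; it is set to `0` for `l = 0`. -/
def gammaQuotient (w : ℂ) (l : ℤ) : ℂ :=
  if l = 0 then 0 else incGamma w (2 * Real.pi * l) / (2 * Real.pi * l) ^ w

lemma two_pi_mul_intCast_pos {l : ℤ} (hl : 0 < l) : (0 : ℝ) < 2 * Real.pi * l :=
  mul_pos Real.two_pi_pos (Int.cast_pos.2 hl)

lemma integral_exp_neg_mul_cpow (w : ℂ) {x : ℝ} (hx : 0 < x) :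
    ∫ t in Set.Ioi (1 : ℝ), (Real.exp (-(x * t)) : ℂ) * (t : ℂ) ^ (w - 1) =
      incGamma w x / (x : ℂ) ^ w := by
  have hx' : (x : ℂ) ≠ 0 := by exact_mod_cast hx.ne'
  have hxw : (x : ℂ) ^ w ≠ 0 := by simp [Complex.cpow_eq_zero_iff, hx']
  have hsubst := integral_comp_mul_left_Ioi' (fun t : ℝ => cexp (-(t : ℂ)) * (t : ℂ) ^ (w - 1)) 1 hx
  have hscale : ∫ t in Set.Ioi (1 : ℝ), cexp (-((x * t : ℝ) : ℂ)) * ((x * t : ℝ) : ℂ) ^ (w - 1) =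
      (x : ℂ) ^ (w - 1) * ∫ t in Set.Ioi (1 : ℝ),
        (Real.exp (-(x * t)) : ℂ) * (t : ℂ) ^ (w - 1) := by
    rw [← integral_const_mul]
    refine setIntegral_congr_fun measurableSet_Ioi fun t ht => ?_
    have ht0 : (0 : ℝ) ≤ t := zero_le_one.trans (le_of_lt ht)
    simp only [Complex.ofReal_mul, Complex.ofReal_exp, Complex.ofReal_neg]
    rw [Complex.mul_cpow_ofReal_nonneg hx.le ht0]
    ring
  rw [mul_one, hscale, Complex.real_smul, Complex.cpow_sub _ _ hx', Complex.cpow_one] at hsubst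
  rw [incGamma, Complex.arg_ofReal_of_nonneg hx.le, intervalIntegral.integral_same, mul_zero,
    sub_zero, Complex.norm_real, Real.norm_of_nonneg hx.le, ← hsubst]
  field_simp

lemma integral_mellinKernel (w : ℂ) {l : ℤ} (hl : 0 < l) :
    ∫ t in Set.Ioi (1 : ℝ), mellinKernel w l t = gammaQuotient w l := by
  have hcast : (2 * Real.pi * (l : ℂ)) = ((2 * Real.pi * l : ℝ) : ℂ) := by push_cast; rfl
  rw [gammaQuotient, if_neg hl.ne', hcast,
    ← integral_exp_neg_mul_cpow w (two_pi_mul_intCast_pos hl)]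
  rfl

lemma norm_mellinKernel (w : ℂ) (l : ℤ) {t : ℝ} (ht : 0 < t) :
    ‖mellinKernel w l t‖ = t ^ (w - 1).re * Real.exp (-(2 * Real.pi * l * t)) := by
  rw [mellinKernel, norm_mul, Complex.norm_cpow_eq_rpow_re_of_pos ht, Complex.norm_real,
    Real.norm_of_nonneg (Real.exp_pos _).le, mul_comm]

lemma norm_mellinKernel_le (w : ℂ) {l : ℤ} (hl : 0 < l) {t : ℝ} (ht : 1 < t) :
    ‖mellinKernel w l t‖ ≤ Real.exp (-(Real.pi * (l - 1))) * ‖mellinKernel w 1 t‖ := by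
  have ht0 : 0 < t := one_pos.trans ht
  have hl1 : (0 : ℝ) ≤ l - 1 := sub_nonneg.2 (by exact_mod_cast hl)
  rw [norm_mellinKernel w l ht0, norm_mellinKernel w 1 ht0, mul_left_comm, ← Real.exp_add]
  gcongr
  push_cast
  nlinarith [mul_nonneg (mul_nonneg Real.pi_pos.le hl1) (by linarith : (0 : ℝ) ≤ 2 * t - 1)]

lemma integrableOn_mellinKernel (w : ℂ) {l : ℤ} (hl : 0 < l) :
    IntegrableOn (mellinKernel w l) (Set.Ioi 1) := by
  have hcont : ContinuousOn (mellinKernel w l) (Set.Ici 1) := fun t ht => by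
    have hpow := Complex.continuousAt_ofReal_cpow_const t (w - 1)
      (Or.inr (one_pos.trans_le ht).ne')
    have hexp : ContinuousAt (fun t : ℝ => (Real.exp (-(2 * Real.pi * l * t)) : ℂ)) t := by fun_prop
    exact (hexp.mul hpow).continuousWithinAt
  have hx : 0 < Real.pi * l := mul_pos Real.pi_pos (Int.cast_pos.2 hl)
  refine (integrable_norm_iff ((hcont.mono Set.Ioi_subset_Ici_self).aestronglyMeasurable
    measurableSet_Ioi)).1 (integrable_of_isBigO_exp_neg hx hcont.norm ?_)
  refine (((isLittleO_rpow_exp_pos_mul_atTop (w - 1).re hx).isBigO.mul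
    (isBigO_refl (fun t : ℝ => Real.exp (-(2 * Real.pi * l * t))) atTop)).congr' ?_ ?_)
  · filter_upwards [eventually_gt_atTop 0] with t ht using (norm_mellinKernel w l ht).symm
  · refine Eventually.of_forall fun t => ?_
    simp only [← Real.exp_add]
    ring_nf

/-! ### The L-function of a Fourier expansion -/

lemma hasSum_prod_of_forall_mem {ι κ E : Type*} [AddCommMonoid E]
    [TopologicalSpace E] [ContinuousAdd E] {S : Finset ι} {g : ι × κ → E} {a : ι → E}
    (h0 : ∀ i ∉ S, ∀ k, g (i, k) = 0) (h : ∀ i ∈ S, HasSum (fun k => g (i, k)) (a i)) :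
    HasSum g (∑ i ∈ S, a i) := by
  classical
  refine (hasSum_sum fun i hi => hasSum_ite_fst_eq (h i hi) i).congr_fun fun p => ?_
  by_cases hp : p.1 ∈ S
  · rw [Finset.sum_eq_single p.1 (fun i _ hi => ?_) fun hp' => absurd hp hp', if_pos rfl]
    exact if_neg hi.symm
  · rw [h0 p.1 hp p.2]
    exact (Finset.sum_eq_zero fun i hi => if_neg fun hpi => hp (by rwa [hpi])).symm

/-- The term of `decayingPart M A (I * t) * t ^ (w - 1)` with exponents `x = (j, m, n)`. -/
def decayingTerm (A : ℤ → ℤ → ℤ → ℂ) (w : ℂ) (x : ℤ × ℤ × ℤ) (t : ℝ) : ℂ :=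
  if 0 < x.2.1 + x.2.2 then
    A x.1 x.2.1 x.2.2 * mellinKernel (w + x.1) (x.2.1 + x.2.2) t else 0

lemma integrableOn_decayingTerm (A : ℤ → ℤ → ℤ → ℂ) (w : ℂ) (x : ℤ × ℤ × ℤ) :
    IntegrableOn (decayingTerm A w x) (Set.Ioi 1) := by
  by_cases hx : 0 < x.2.1 + x.2.2
  · rw [show decayingTerm A w x = _ from funext fun t => if_pos hx]
    exact (integrableOn_mellinKernel _ hx).const_mul _
  · rw [show decayingTerm A w x = _ from funext fun t => if_neg hx]
    exact integrableOn_zero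

lemma integral_decayingTerm (A : ℤ → ℤ → ℤ → ℂ) (w : ℂ) (x : ℤ × ℤ × ℤ) :
    ∫ t in Set.Ioi (1 : ℝ), decayingTerm A w x t = if 0 < x.2.1 + x.2.2 then
      A x.1 x.2.1 x.2.2 * gammaQuotient (w + x.1) (x.2.1 + x.2.2) else 0 := by
  by_cases hx : 0 < x.2.1 + x.2.2
  · simp only [decayingTerm, if_pos hx, integral_const_mul, integral_mellinKernel _ hx]
  · simp only [decayingTerm, if_neg hx, integral_zero]

lemma norm_decayingTerm_le (A : ℤ → ℤ → ℤ → ℂ) (w : ℂ) (x : ℤ × ℤ × ℤ) {t : ℝ} (ht : 1 < t) :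
    ‖decayingTerm A w x t‖ ≤ ‖A x.1 x.2.1 x.2.2‖ * Real.exp (-(Real.pi * (x.2.1 + x.2.2 - 1))) *
      ‖mellinKernel (w + x.1) 1 t‖ := by
  rw [decayingTerm]
  split_ifs with hx
  · rw [norm_mul, mul_assoc]
    gcongr
    simpa only [Int.cast_add] using norm_mellinKernel_le (w + x.1) hx ht
  · rw [norm_zero]
    positivity

lemma integral_norm_decayingTerm_le (A : ℤ → ℤ → ℤ → ℂ) (w : ℂ) (x : ℤ × ℤ × ℤ) :
    ∫ t in Set.Ioi (1 : ℝ), ‖decayingTerm A w x t‖ ≤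
      ‖A x.1 x.2.1 x.2.2‖ * Real.exp (-(Real.pi * (x.2.1 + x.2.2 - 1))) *
        ∫ t in Set.Ioi (1 : ℝ), ‖mellinKernel (w + x.1) 1 t‖ := by
  rw [← integral_const_mul]
  exact setIntegral_mono_on (integrableOn_decayingTerm A w x).norm
    ((integrableOn_mellinKernel _ one_pos).norm.const_mul _) measurableSet_Ioi
    fun t ht => norm_decayingTerm_le A w x ht

namespace IsFourierExpansion

variable {f : ℍ → ℂ} {M N : ℕ} {A : ℤ → ℤ → ℤ → ℂ}

lemma summable_integral_norm_decayingTerm (h : IsFourierExpansion f M N A) (w : ℂ) :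
    Summable fun x => ∫ t in Set.Ioi (1 : ℝ), ‖decayingTerm A w x t‖ := by
  have hrow : ∀ j : ℤ, Summable fun p : ℤ × ℤ =>
      ‖A j p.1 p.2‖ * Real.exp (-(Real.pi * (p.1 + p.2 - 1))) := fun j => by
    refine (((h.isConvergent j).summable_norm_mul_exp one_half_pos).mul_right
      (Real.exp Real.pi)).congr fun p => ?_
    rw [mul_assoc, ← Real.exp_add]
    ring_nf
  have hsum (W : ℤ → ℝ) : Summable fun x : ℤ × ℤ × ℤ =>
      ‖A x.1 x.2.1 x.2.2‖ * Real.exp (-(Real.pi * (x.2.1 + x.2.2 - 1))) * W x.1 := by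
    refine (hasSum_prod_of_forall_mem (S := Finset.Icc (-(M : ℤ)) M) (fun j hj p => ?_)
      fun j _ => ((hrow j).mul_right (W j)).hasSum).summable
    simp only [h.coeff_eq_zero hj, norm_zero, zero_mul]
  exact (hsum fun j => ∫ t in Set.Ioi (1 : ℝ), ‖mellinKernel (w + j) 1 t‖).of_nonneg_of_le
    (fun x => integral_nonneg fun t => norm_nonneg _) (integral_norm_decayingTerm_le A w)

lemma hasSum_decayingTerm (h : IsFourierExpansion f M N A) (w : ℂ) {t : ℝ} (ht : 0 < t) :
    HasSum (fun x => decayingTerm A w x t) (decayingPart M A (I * t) * (t : ℂ) ^ (w - 1)) := by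
  have him : (I * t : ℂ).im = t := by simp
  have ht0 : (t : ℂ) ≠ 0 := by exact_mod_cast ht.ne'
  rw [decayingPart, Finset.sum_mul, him]
  refine hasSum_prod_of_forall_mem (fun j hj p => ?_) fun j _ => ?_
  · simp only [decayingTerm, h.coeff_eq_zero hj, zero_mul, ite_self]
  have hsum : Summable fun p : ℤ × ℤ =>
      if 0 < p.1 + p.2 then A j p.1 p.2 * nomeMonomial p.1 p.2 (I * t) else 0 :=
    ((h.summable j ⟨I * t, him.symm ▸ ht⟩).indicator {p | 0 < p.1 + p.2}).congr
      fun p => Set.indicator_apply _ _ _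
  refine ((hsum.hasSum.mul_left _).mul_right _).congr_fun fun p => ?_
  rw [decayingTerm, nomeMonomial_I_mul, mellinKernel, add_sub_right_comm,
    Complex.cpow_add _ _ ht0, Complex.cpow_intCast, mul_ite, ite_mul, mul_zero, zero_mul]
  refine if_congr Iff.rfl ?_ rfl
  push_cast
  ring

lemma hasSum_integral_decayingPart (h : IsFourierExpansion f M N A) (w : ℂ) :
    HasSum (fun x : ℤ × ℤ × ℤ => if 0 < x.2.1 + x.2.2 then
        A x.1 x.2.1 x.2.2 * gammaQuotient (w + x.1) (x.2.1 + x.2.2) else 0)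
      (∫ t in Set.Ioi (1 : ℝ), decayingPart M A (I * t) * (t : ℂ) ^ (w - 1)) := by
  have hsum := hasSum_integral_of_summable_integral_norm
    (fun x => integrableOn_decayingTerm A w x) (h.summable_integral_norm_decayingTerm w)
  simp only [integral_decayingTerm] at hsum
  rwa [setIntegral_congr_fun measurableSet_Ioi fun t ht =>
    (h.hasSum_decayingTerm w (one_pos.trans ht)).tsum_eq] at hsum

lemma hasSum_growingPart (h : IsFourierExpansion f M N A) (w : ℂ) :
    HasSum (fun x : ℤ × ℤ × ℤ => if x.2.1 + x.2.2 < 0 then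
        A x.1 x.2.1 x.2.2 * gammaQuotient (w + x.1) (x.2.1 + x.2.2) else 0)
      (∑ j ∈ Finset.Icc (-(M : ℤ)) (M : ℤ),
        ∑ m ∈ Finset.Icc (-(N : ℤ)) (N : ℤ), ∑ n ∈ Finset.Icc (-(N : ℤ)) (N : ℤ),
          if m + n < 0 then
            A j m n / (2 * Real.pi * ((m : ℂ) + n)) ^ ((j : ℂ) + w)
              * incGamma ((j : ℂ) + w) (2 * Real.pi * ((m : ℂ) + n))
          else 0) := by
  have hterm : ∀ j m n : ℤ, (if m + n < 0 then
      A j m n / (2 * Real.pi * ((m : ℂ) + n)) ^ ((j : ℂ) + w)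
        * incGamma ((j : ℂ) + w) (2 * Real.pi * ((m : ℂ) + n)) else 0) =
      if m + n < 0 then A j m n * gammaQuotient (w + j) (m + n) else 0 := fun j m n => by
    refine ite_congr rfl (fun hmn => ?_) fun _ => rfl
    rw [gammaQuotient, if_neg hmn.ne, Int.cast_add, add_comm w]
    ring
  simp only [hterm, ← Finset.sum_product']
  refine hasSum_sum_of_ne_finset_zero fun x hx => ite_eq_right_iff.2 fun hneg => ?_
  rw [h.support, zero_mul]
  simp only [Finset.mem_product, Finset.mem_Icc] at hx
  rw [lt_abs]
  omega

theorem hasSum_halfL (h : IsFourierExpansion f M N A) (w : ℂ) :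
    HasSum (fun x : ℤ × ℤ × ℤ => A x.1 x.2.1 x.2.2 * gammaQuotient (w + x.1) (x.2.1 + x.2.2))
      (halfL M N A w + ∑ j ∈ Finset.Icc (-(M : ℤ)) (M : ℤ),
        ∑ m ∈ Finset.Icc (-(N : ℤ)) (N : ℤ), ∑ n ∈ Finset.Icc (-(N : ℤ)) (N : ℤ),
          if m + n = 0 then A j m n / (w + j) else 0) := by
  rw [halfL, sub_add_cancel]
  refine ((h.hasSum_integral_decayingPart w).add (h.hasSum_growingPart w)).congr_fun fun x => ?_
  rcases lt_trichotomy (x.2.1 + x.2.2) 0 with hx | hx | hx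
  · simp only [if_pos hx, if_neg hx.not_gt, zero_add]
  · simp only [hx, lt_self_iff_false, if_false, gammaQuotient, if_true, mul_zero, add_zero]
  · simp only [if_pos hx, if_neg hx.not_gt, add_zero]

end IsFourierExpansion

/-! ### The L-function of an eigenform -/

lemma seriesTerm_eq_mul_gammaQuotient (E : EigenCoeffs) (w : ℂ) (p : ℤ × ℤ) :
    seriesTerm E w p = (E.a p.1 p.2 + E.b p.1 p.2) * gammaQuotient (w + p.1) p.2 := by
  rw [seriesTerm, gammaQuotient, mul_ite, mul_zero, mul_div_assoc]

lemma EigenCoeffs.hasSum_doubleCoeff_antidiagonal (E : EigenCoeffs) (r s k₀ j : ℤ) {l : ℤ}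
    (hl : l ≠ 0) : HasSum (fun m => E.doubleCoeff r s k₀ j m (l - m)) (E.a j l + E.b j l) := by
  refine ((hasSum_ite_eq l (E.a j l)).add (hasSum_ite_eq 0 (E.b j l))).congr_fun fun m => ?_
  have hconst : ¬(m = 0 ∧ l - m = 0) := by omega
  rw [doubleCoeff, if_neg hconst, zero_add]
  congr 1
  · exact ite_congr (by rw [sub_eq_zero, eq_comm (a := l)]) (fun hm => by rw [hm]) fun _ => rfl
  · exact ite_congr rfl (fun hm => by rw [hm, sub_zero]) fun _ => rfl

theorem IsFourierExpansion.hasSum_seriesTerm {r s k₀ : ℤ} {f : ℍ → ℂ} {E : EigenCoeffs} {M N : ℕ}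
    (hA : IsFourierExpansion f M N (E.doubleCoeff r s k₀)) (w : ℂ) :
    HasSum (seriesTerm E w) (halfL M N (E.doubleCoeff r s k₀) w +
      ∑ j ∈ Finset.Icc (-(M : ℤ)) (M : ℤ),
        ∑ m ∈ Finset.Icc (-(N : ℤ)) (N : ℤ), ∑ n ∈ Finset.Icc (-(N : ℤ)) (N : ℤ),
          if m + n = 0 then E.doubleCoeff r s k₀ j m n / (w + j) else 0) := by
  let e : (ℤ × ℤ) × ℤ ≃ ℤ × ℤ × ℤ :=
    { toFun := fun x => (x.1.1, x.2, x.1.2 - x.2)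
      invFun := fun x => ((x.1, x.2.1 + x.2.2), x.2.1)
      left_inv := fun x => by simp
      right_inv := fun x => by simp }
  refine (e.hasSum_iff.2 (hA.hasSum_halfL w)).prod_fiberwise fun p => ?_
  rw [seriesTerm_eq_mul_gammaQuotient]
  simp only [Function.comp_apply, e, Equiv.coe_fn_mk, add_sub_cancel]
  by_cases hp : p.2 = 0
  · simpa only [hp, gammaQuotient, if_true, mul_zero] using hasSum_zero
  · exact (E.hasSum_doubleCoeff_antidiagonal r s k₀ p.1 hp).mul_right _

namespace IsEigenExpansion

variable {r s k₀ : ℤ} {f : ℍ → ℂ} {E : EigenCoeffs} {M N : ℕ}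

theorem summable_norm_seriesTerm (h : IsEigenExpansion r s k₀ f E) (w : ℂ) :
    Summable fun p => ‖seriesTerm E w p‖ := by
  obtain ⟨M, N, hA⟩ := h.isFourierExpansion
  exact (hA.hasSum_seriesTerm w).summable.norm

lemma sum_antidiagonal_zero_eq (h : IsEigenExpansion r s k₀ f E) (hk : k₀ < 1 - r - s - k₀)
    (hA : IsFourierExpansion f M N (E.doubleCoeff r s k₀)) (w : ℂ) :
    (∑ j ∈ Finset.Icc (-(M : ℤ)) (M : ℤ),
      ∑ m ∈ Finset.Icc (-(N : ℤ)) (N : ℤ), ∑ n ∈ Finset.Icc (-(N : ℤ)) (N : ℤ),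
        if m + n = 0 then E.doubleCoeff r s k₀ j m n / (w + j) else 0) =
      E.α / (w + k₀) + E.β / (w + (1 - r - s - k₀)) := by
  have hterm : ∀ j m n : ℤ, (if m + n = 0 then E.doubleCoeff r s k₀ j m n / (w + j) else 0) =
      if n = 0 then if m = 0 then E.doubleCoeff r s k₀ j 0 0 / (w + j) else 0 else 0 := by
    intro j m n
    by_cases hm : m = 0 <;> by_cases hn : n = 0 <;>
      simp [hm, hn, EigenCoeffs.doubleCoeff]
  have h0 : (0 : ℤ) ∈ Finset.Icc (-(N : ℤ)) (N : ℤ) := by simp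
  have hα : k₀ ∉ Finset.Icc (-(M : ℤ)) (M : ℤ) → E.α = 0 := fun hj => by
    simpa [h.doubleCoeff_zero, EigenCoeffs.constCoeff, hk.ne] using hA.coeff_eq_zero hj 0 0
  have hβ : 1 - r - s - k₀ ∉ Finset.Icc (-(M : ℤ)) (M : ℤ) → E.β = 0 := fun hj => by
    simpa [h.doubleCoeff_zero, EigenCoeffs.constCoeff, hk.ne'] using hA.coeff_eq_zero hj 0 0
  simp only [hterm, Finset.sum_ite_eq', h0, if_true, h.doubleCoeff_zero, EigenCoeffs.constCoeff,
    add_div, ite_div, zero_div, Finset.sum_add_distrib]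
  congr 1
  · split_ifs with hj
    · rfl
    · rw [hα hj, zero_div]
  · push_cast
    split_ifs with hj
    · rfl
    · rw [hβ hj, zero_div]

theorem halfL_eq (h : IsEigenExpansion r s k₀ f E) (hk : k₀ < 1 - r - s - k₀)
    (hA : IsFourierExpansion f M N (E.doubleCoeff r s k₀)) (w : ℂ) :
    halfL M N (E.doubleCoeff r s k₀) w = ∑' p : ℤ × ℤ, seriesTerm E w p -
      (E.α / (w + k₀) + E.β / (w + (1 - r - s - k₀))) := by
  rw [(hA.hasSum_seriesTerm w).tsum_eq, h.sum_antidiagonal_zero_eq hk hA, add_sub_cancel_right]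

theorem completedL_eq (h : IsEigenExpansion r s k₀ f E) (hk : k₀ < 1 - r - s - k₀)
    {A : ℤ → ℤ → ℤ → ℂ} (hA : IsFourierExpansion f M N A) (w : ℂ) :
    completedL r s M N A w = ∑' p : ℤ × ℤ, seriesTerm E w p
      + I ^ (r - s) * ∑' p : ℤ × ℤ, seriesTerm E ((r : ℂ) + s - w) p
      + polarPart r s k₀ E w := by
  obtain rfl := h.eq_doubleCoeff hA
  have hα : (r : ℂ) + s - w + k₀ = -(w - k₀ - r - s) := by ring
  have hβ : (r : ℂ) + s - w + (1 - r - s - k₀) = -(w + k₀ - 1) := by ring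
  have hβ' : w + (1 - r - s - k₀) = w - k₀ - r - s + 1 := by ring
  rw [completedL, h.halfL_eq hk hA, h.halfL_eq hk hA, polarPart, hα, hβ, hβ', div_neg, div_neg]
  ring

end IsEigenExpansion

end

end RealAnalyticModular

open RealAnalyticModular in
theorem proposition3p2_general (r s : ℤ) (lam : ℂ) (f : ℍ → ℂ) (hf : IsModularForm r s f)
    (hΔ : ∀ z : ℍ, laplacian r s f z = lam * f z) :
    (f ≠ 0 → ∃ k₀ : ℤ, k₀ < 1 - r - s - k₀ ∧ lam = ((k₀ * (1 - r - s - k₀) : ℤ) : ℂ)) ∧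
    ∀ k₀ : ℤ, k₀ < 1 - r - s - k₀ → lam = ((k₀ * (1 - r - s - k₀) : ℤ) : ℂ) →
      (∃! E : EigenCoeffs,
        IsEigenExpansion r s k₀ f E) ∧
      ∀ E : EigenCoeffs,
        IsEigenExpansion r s k₀ f E →
        (∀ j ∈ Finset.Icc k₀ (-s), ∃ C : ℝ, 0 < C ∧
          (fun n : ℕ => E.a j (n : ℤ)) =O[atTop] fun n : ℕ => Real.exp (C * √(n : ℝ))) ∧
        (∀ j ∈ Finset.Icc k₀ (-r), ∃ C : ℝ, 0 < C ∧
          (fun n : ℕ => E.b j (n : ℤ)) =O[atTop] fun n : ℕ => Real.exp (C * √(n : ℝ))) ∧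
        (∀ w : ℂ,
          Summable (fun p : ℤ × ℤ => ‖seriesTerm E w p‖) ∧
          Summable (fun p : ℤ × ℤ =>
            ‖seriesTerm E ((r : ℂ) + s - w) p‖)) ∧
        (∀ (M N : ℕ) (A : ℤ → ℤ → ℤ → ℂ), IsFourierExpansion f M N A →
          ∀ w : ℂ, w ≠ -k₀ → w ≠ -k₀ + 1 → w ≠ k₀ + r + s - 1 → w ≠ k₀ + r + s →
            completedL r s M N A w =
              ∑' p : ℤ × ℤ, seriesTerm E w p
              + I ^ (r - s) *
                ∑' p : ℤ × ℤ, seriesTerm E ((r : ℂ) + s - w) p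
              + polarPart r s k₀ E w) := by
  refine ⟨hf.exists_root hΔ, fun k₀ hk hlam => ⟨?_, fun E hE =>
    ⟨fun j _ => hE.isBigO_a hf j, fun j _ => hE.isBigO_b hf j,
      fun w => ⟨hE.summable_norm_seriesTerm w, hE.summable_norm_seriesTerm _⟩,
      fun M N A hA w _ _ _ _ => hE.completedL_eq hk hA w⟩⟩⟩
  obtain ⟨M, N, A, hA⟩ := hf.expansion
  exact hA.existsUnique_isEigenExpansion (hlam ▸ hΔ) hk

theorem proposition3p2 (r s : ℤ) (hrs : Even (r - s)) (lam : ℝ) (f : ℍ → ℂ)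
    (hf : RealAnalyticModular.IsEigenform r s lam f) :
    (f ≠ 0 → ∃ k₀ : ℤ, k₀ < 1 - r - s - k₀ ∧ lam = ((k₀ * (1 - r - s - k₀) : ℤ) : ℝ)) ∧
    ∀ k₀ : ℤ, k₀ < 1 - r - s - k₀ → lam = ((k₀ * (1 - r - s - k₀) : ℤ) : ℝ) →
      (∃! E : RealAnalyticModular.EigenCoeffs,
        RealAnalyticModular.IsEigenExpansion r s k₀ f E) ∧
      ∀ E : RealAnalyticModular.EigenCoeffs,
        RealAnalyticModular.IsEigenExpansion r s k₀ f E →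
        (∀ j ∈ Finset.Icc k₀ (-s), ∃ C : ℝ, 0 < C ∧
          (fun n : ℕ => E.a j (n : ℤ)) =O[atTop] fun n : ℕ => Real.exp (C * √(n : ℝ))) ∧
        (∀ j ∈ Finset.Icc k₀ (-r), ∃ C : ℝ, 0 < C ∧
          (fun n : ℕ => E.b j (n : ℤ)) =O[atTop] fun n : ℕ => Real.exp (C * √(n : ℝ))) ∧
        (∀ w : ℂ,
          Summable (fun p : ℤ × ℤ => ‖RealAnalyticModular.seriesTerm E w p‖) ∧
          Summable (fun p : ℤ × ℤ =>
            ‖RealAnalyticModular.seriesTerm E ((r : ℂ) + s - w) p‖)) ∧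
        (∀ (M N : ℕ) (A : ℤ → ℤ → ℤ → ℂ), RealAnalyticModular.IsFourierExpansion f M N A →
          ∀ w : ℂ, w ≠ -k₀ → w ≠ -k₀ + 1 → w ≠ k₀ + r + s - 1 → w ≠ k₀ + r + s →
            RealAnalyticModular.completedL r s M N A w =
              ∑' p : ℤ × ℤ, RealAnalyticModular.seriesTerm E w p
              + I ^ (r - s) *
                ∑' p : ℤ × ℤ, RealAnalyticModular.seriesTerm E ((r : ℂ) + s - w) p
              + RealAnalyticModular.polarPart r s k₀ E w) := by
  exact_mod_cast proposition3p2_general r s lam f hf.isModularForm hf.laplacian_eq
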